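/- Let $\Theta\subseteq(0,\infty)$ have non-empty interior. For $\vartheta\in\Theta$ let $X_t=\sum_{i=1}^{N_t}\varepsilon_i$, $t\ge 0$, where under $\mathbb P_\vartheta$ the process $(N_t)$ is a homogeneous Poisson process with intensity $\vartheta$ and the $\varepsilon_i$ are i.i.d. uniform on $\{-1,1\}$ and independent of $(N_t)$. For $0<\Delta\le T$ let $\mathbb P_\vartheta^{T,\Delta}$ be the law on $\mathbb Z^{\lfloor T/\Delta\rfloor}$ of $\boldsymbol X=(X_\Delta,X_{2\Delta},\dots,X_{\lfloor T/\Delta\rfloor\Delta})$ under $\mathbb P_\vartheta$. For $T,\Delta>0$ put $$I_{T,\Delta}(\vartheta)=T\Delta\,\mathbb E_\vartheta\Big[\big(h_\Delta(\vartheta,X_\Delta)+(\vartheta\Delta)^{-1}|X_\Delta|-1\big)^2\Big],\qquad h_\Delta(\vartheta,k)=\frac{\mathcal I_{|k|+1}(\vartheta\Delta)}{\mathcal I_{|k|}(\vartheta\Delta)},$$ where $\mathcal I_\nu(x)=\sum_{m\ge0}\frac{(x/2)^{2m+\nu}}{m!\,(\nu+m)!}$ for $\nu\in\mathbb N$. Let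 $0<\Delta_T\le T$ for all $T>0$ and suppose that $\Delta_T\to\Delta_\infty\in(0,\infty)$ as $T\to\infty$. Then, for every $\vartheta\in\Theta$, $$\frac{I_{T,\Delta_T}(\vartheta)}{I_{T,\Delta_\infty}(\vartheta)}\to1\quad\text{as }T\to\infty,$$ and the experiments $\{\mathbb P_\theta^{T,\Delta_T},\theta\in\Theta\}$ are locally asymptotically normal at $\vartheta$ both with normalisation $J_T=I_{T,\Delta_T}(\vartheta)$ and with normalisation $J_T=I_{T,\Delta_\infty}(\vartheta)$. That is: $J_T>0$ for all $T>0$, and there are random variables $\xi_T=\xi_T(\boldsymbol X)$, converging in distribution to $\mathcal N(0,1)$ under $\mathbb P_\vartheta^{T,\Delta_T}$ as $T\to\infty$, and for each $v\in\mathbb R$ random variables $r_T=r_T(v,\boldsymbol X)$, converging to $0$ in probability under $\mathbb P_\vartheta^{T,\Delta_T}$, such that for every $T>0$ with $\vartheta+vJ_T^{-1/2}\in\Theta$, $$\frac{d\mathbb P^{T,\Delta_T}_{\vartheta+vJ_T^{-1/2}}}{d\mathbb P^{T,\Delta_T}_{\vartheta}}(\boldsymbol X)=\exp\Big(v\,\xi_T-\tfrac12v^2+r_T\Big)\qquad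 \mathbb P_\vartheta^{T,\Delta_T}\text{-almost surely}.$$ -/

import Mathlib

open MeasureTheory ProbabilityTheory Filter Topology Asymptotics
open scoped NNReal ENNReal Nat BoundedContinuousFunction

/-- `N` is a standard homogeneous Poisson process with intensity `ϑ` under `P`: it starts at `0`,
has nondecreasing right-continuous paths with values in `ℕ`, independent increments, and
`N t - N s` is Poisson distributed with parameter `ϑ (t - s)` for `s ≤ t`. -/
structure IsPoissonProcess {Ω : Type*} [MeasurableSpace Ω] (P : Measure Ω) (ϑ : ℝ)
    (N : ℝ≥0 → Ω → ℕ) : Prop where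
  measurable : ∀ t, Measurable (N t)
  zero : ∀ᵐ ω ∂P, N 0 ω = 0
  mono : ∀ᵐ ω ∂P, Monotone fun t => N t ω
  right_continuous : ∀ᵐ ω ∂P, ∀ t, ContinuousWithinAt (fun s => N s ω) (Set.Ici t) t
  indep_increments : HasIndepIncrements N P
  law_increments : ∀ s t, s ≤ t →
    HasLaw (fun ω => N t ω - N s ω) (poissonMeasure (ϑ.toNNReal * (t - s))) P

/-- `ε 0, ε 1, …` are independent, uniformly distributed on `{-1, 1}` under `P`. -/
structure IsSymmetricSigns {Ω : Type*} [MeasurableSpace Ω] (P : Measure Ω)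
    (ε : ℕ → Ω → ℤ) : Prop where
  measurable : ∀ i, Measurable (ε i)
  indep : iIndepFun ε P
  prob_one : ∀ i, P {ω | ε i ω = 1} = 1 / 2
  prob_neg_one : ∀ i, P {ω | ε i ω = -1} = 1 / 2

/-- `X` is, under `P`, a compound Poisson process with intensity `ϑ`, symmetric jumps `±1` and
`X 0 = 0`: there are a Poisson process `N` with intensity `ϑ` and, independent of `N`, a sequence
of independent symmetric signs `ε` such that `X t` is the sum of the first `N t` signs. -/
def IsSymmetricCompoundPoisson {Ω : Type*} [MeasurableSpace Ω] (P : Measure Ω) (ϑ : ℝ)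
    (X : ℝ≥0 → Ω → ℤ) : Prop :=
  ∃ (N : ℝ≥0 → Ω → ℕ) (ε : ℕ → Ω → ℤ),
    IsPoissonProcess P ϑ N ∧ IsSymmetricSigns P ε ∧
    IndepFun (fun ω i => ε i ω) (fun ω t => N t ω) P ∧
    ∀ t ω, X t ω = ∑ i ∈ Finset.range (N t ω), ε i ω

/-- The law on `ℤ ^ ⌊T/Δ⌋` of the observation `(X_Δ, X_{2Δ}, …, X_{⌊T/Δ⌋Δ})`. -/
noncomputable def observationLaw {Ω : Type*} [MeasurableSpace Ω] (P : Measure Ω)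
    (X : ℝ≥0 → Ω → ℤ) (T Δ : ℝ) : Measure (Fin ⌊T / Δ⌋₊ → ℤ) :=
  P.map fun ω i => X (((i : ℕ) + 1 : ℝ) * Δ).toNNReal ω

/-- Local asymptotic normality at `ϑ`, as `T → ∞`, of the family of experiments
`{Q T θ : θ ∈ Θ}`, `T > 0`, with normalisation `I T > 0` (the information).
The random variable `ξ T` does not depend on the direction `v`, the remainder `r T` does. -/
def IsLAN {E : ℝ → Type*} [∀ T, MeasurableSpace (E T)] (Θ : Set ℝ)
    (Q : (T : ℝ) → ℝ → Measure (E T)) (ϑ : ℝ) (I : ℝ → ℝ) : Prop :=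
  (∀ T, 0 < T → 0 < I T) ∧
  ∃ ξ : (T : ℝ) → E T → ℝ,
    (∀ T, Measurable (ξ T)) ∧
    (∀ g : ℝ →ᵇ ℝ, Tendsto (fun T => ∫ x, g (ξ T x) ∂(Q T ϑ)) atTop
      (𝓝 (∫ y, g y ∂(gaussianReal 0 1)))) ∧
    ∀ v : ℝ, ∃ r : (T : ℝ) → E T → ℝ,
      (∀ T, Measurable (r T)) ∧
      (∀ T, 0 < T → ϑ + v / √(I T) ∈ Θ →
        ∀ᵐ x ∂(Q T ϑ), ((Q T (ϑ + v / √(I T))).rnDeriv (Q T ϑ) x).toReal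
          = Real.exp (v * ξ T x - v ^ 2 / 2 + r T x)) ∧
      ∀ δ : ℝ, 0 < δ → Tendsto (fun T => Q T ϑ {x | δ ≤ |r T x|}) atTop (𝓝 0)

/-- The modified Bessel function of the first kind of order `ν ∈ ℕ`. -/
noncomputable def besselI (ν : ℕ) (x : ℝ) : ℝ :=
  ∑' m : ℕ, (x / 2) ^ (2 * m + ν) / ((m ! : ℝ) * ((ν + m)! : ℝ))

/-- `h_Δ(ϑ, k) = I_{|k|+1}(ϑ Δ) / I_{|k|}(ϑ Δ)`. -/
noncomputable def besselRatio (Δ ϑ : ℝ) (k : ℤ) : ℝ :=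
  besselI (k.natAbs + 1) (ϑ * Δ) / besselI k.natAbs (ϑ * Δ)

/-- `I_{T,Δ}(ϑ) = T Δ E[(h_Δ(ϑ, X_Δ) + (ϑ Δ)⁻¹ |X_Δ| - 1)²]`, the expectation being under `P`. -/
noncomputable def scaleInformation {Ω : Type*} [MeasurableSpace Ω] (P : Measure Ω)
    (X : ℝ≥0 → Ω → ℤ) (T Δ ϑ : ℝ) : ℝ :=
  T * Δ * ∫ ω, (besselRatio Δ ϑ (X Δ.toNNReal ω)
    + (ϑ * Δ)⁻¹ * |(X Δ.toNNReal ω : ℝ)| - 1) ^ 2 ∂P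

/-!
By independent increments, the successive differences of the observations form a sample of size
`⌊T/Δ⌋` from the symmetric Skellam law with parameter `x = ϑ Δ`, whose mass function is
`p_x(k) = exp(-x) I_{|k|}(x)`. As `x` is the time of a continuous-time random walk, `∂ₓ p_x` is the
discrete Laplacian of `p_x`; hence the score `∂ₓ log p_x(k)` is a ratio of values of `p_x` at
neighbouring points, equal to `h_Δ(ϑ, k) + |k| / x - 1`, and `I_{T,Δ}(ϑ) = T Δ F(ϑ Δ)` with `F` the
Fisher information of the Skellam family. On compact sets of parameters, the first three logarithmic
derivatives grow at most polynomially in `k` while the tails of `p_x` are super-exponentially small,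
so that the log-likelihood ratio of the sample can be expanded to second order: the score sum is
asymptotically normal by a central limit theorem for rows of i.i.d. variables with third moments,
and what remains converges to `0` in `L¹`.
-/

section CentralLimit

theorem tendsto_pow_exp_of_tendsto_mul_sub_one {ι : Type*} {l : Filter ι} {n : ι → ℕ}
    {a : ι → ℂ} {z : ℂ} (hn : Tendsto n l atTop)
    (ha : Tendsto (fun i => (n i : ℂ) * (a i - 1)) l (𝓝 z)) :
    Tendsto (fun i => a i ^ n i) l (𝓝 (Complex.exp z)) := by
  have hinv : Tendsto (fun i => (n i : ℂ)⁻¹) l (𝓝 0) :=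
    (tendsto_inv_atTop_nhds_zero_nat (𝕜 := ℂ)).comp hn
  have hn0 : ∀ᶠ i in l, (n i : ℂ) ≠ 0 :=
    (hn.eventually_gt_atTop 0).mono fun i hi => Nat.cast_ne_zero.2 hi.ne'
  have hg : Tendsto (fun i => a i - 1) l (𝓝 0) := by
    refine (zero_mul z ▸ hinv.mul ha).congr' ?_
    filter_upwards [hn0] with i hi using inv_mul_cancel_left₀ hi _
  have hlog : Tendsto (fun i => (n i : ℂ) * (Complex.log (1 + (a i - 1)) - (a i - 1))) l (𝓝 0) := by
    refine ((isBigO_refl (fun i => (n i : ℂ)) l).mul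
      (Complex.log_sub_self_isBigO.comp_tendsto hg)).trans_tendsto ?_
    have hsq : Tendsto (fun i => ((n i : ℂ) * (a i - 1)) ^ 2 * (n i : ℂ)⁻¹) l (𝓝 0) := by
      simpa using (ha.pow 2).mul hinv
    refine hsq.congr' ?_
    filter_upwards [hn0] with i hi
    simp only [Function.comp_apply]
    field_simp
  have hexp := (Complex.continuous_exp.tendsto z).comp (zero_add z ▸ hlog.add ha)
  refine hexp.congr' ?_
  filter_upwards [hg.eventually_ne (show (0 : ℂ) ≠ -1 by simp)] with i hi
  have h0 : a i ≠ 0 := fun h => hi (by simp [h])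
  simp only [Function.comp_apply]
  rw [add_sub_cancel, mul_sub, sub_add_cancel, Complex.exp_nat_mul, Complex.exp_log h0]

theorem norm_exp_mul_I_sub_taylor_le (u : ℝ) :
    ‖Complex.exp (u * Complex.I) - (1 + u * Complex.I - (u : ℂ) ^ 2 / 2)‖ ≤ 4 * |u| ^ 3 := by
  have hn : ‖(u : ℂ) * Complex.I‖ = |u| := by simp
  rcases le_or_gt |u| 1 with hu | hu
  · have h := Complex.norm_exp_sub_sum_le_norm_mul_exp ((u : ℂ) * Complex.I) 3
    have hsum : ∑ m ∈ Finset.range 3, ((u : ℂ) * Complex.I) ^ m / (m ! : ℂ)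
        = 1 + u * Complex.I - (u : ℂ) ^ 2 / 2 := by
      simp only [mul_pow, Finset.sum_range_succ, Finset.range_one, Finset.sum_singleton, pow_zero,
        mul_one, Nat.factorial_zero, Nat.cast_one, ne_eq, one_ne_zero, not_false_eq_true, div_self,
        pow_one, Nat.factorial_one, div_one, Complex.I_sq, mul_neg, Nat.factorial_two,
        Nat.cast_ofNat]
      ring
    rw [hsum, hn] at h
    have hexp : Real.exp |u| ≤ 4 :=
      (Real.exp_le_exp.2 hu).trans (Real.exp_one_lt_d9.le.trans (by norm_num))
    calc _ ≤ |u| ^ 3 * Real.exp |u| := h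
      _ ≤ |u| ^ 3 * 4 := by gcongr
      _ = 4 * |u| ^ 3 := mul_comm _ _
  · have hpoly : ‖1 + (u : ℂ) * Complex.I - (u : ℂ) ^ 2 / 2‖ ≤ 1 + |u| + |u| ^ 2 / 2 := by
      refine (norm_sub_le _ _).trans (add_le_add ((norm_add_le _ _).trans ?_) ?_)
      · rw [hn, norm_one]
      · simp
    have h1 : |u| ≤ |u| ^ 3 := le_self_pow₀ hu.le three_ne_zero
    have h2 : |u| ^ 2 ≤ |u| ^ 3 := pow_le_pow_right₀ hu.le (by norm_num)
    refine (norm_sub_le _ _).trans ?_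
    rw [Complex.norm_exp_ofReal_mul_I]
    linarith

variable {E : Type*} [MeasurableSpace E] {μ : Measure E} [IsProbabilityMeasure μ] {f : E → ℝ}

theorem norm_charFun_map_sub_taylor_le (hf : MemLp f 3 μ) (h0 : ∫ y, f y ∂μ = 0) (t : ℝ) :
    ‖charFun (μ.map f) t - (1 - (t ^ 2 * ∫ y, f y ^ 2 ∂μ : ℝ) / 2)‖
      ≤ 4 * |t| ^ 3 * ∫ y, |f y| ^ 3 ∂μ := by
  have h1 : Integrable f μ := hf.integrable (by norm_num)
  have h2 : Integrable (fun y => f y ^ 2) μ :=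
    (hf.mono_exponent (by norm_num : (2 : ℝ≥0∞) ≤ 3)).integrable_sq
  have h3 : Integrable (fun y => |f y| ^ 3) μ := by
    simpa using hf.integrable_norm_pow (p := 3) (by norm_num)
  have hsplit : ∀ y, 1 + ((t * f y : ℝ) : ℂ) * Complex.I - ((t * f y : ℝ) : ℂ) ^ 2 / 2
      = ((1 - t ^ 2 * f y ^ 2 / 2 : ℝ) : ℂ) + ((t * f y : ℝ) : ℂ) * Complex.I := fun y => by
    push_cast
    ring
  have hre : Integrable (fun y => ((1 - t ^ 2 * f y ^ 2 / 2 : ℝ) : ℂ)) μ :=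
    ((integrable_const _).sub ((h2.const_mul _).div_const _)).ofReal
  have him : Integrable (fun y => ((t * f y : ℝ) : ℂ) * Complex.I) μ :=
    (h1.const_mul t).ofReal.mul_const _
  have htaylor : ∫ y, (1 + ((t * f y : ℝ) : ℂ) * Complex.I - ((t * f y : ℝ) : ℂ) ^ 2 / 2 : ℂ) ∂μ
      = 1 - (t ^ 2 * ∫ y, f y ^ 2 ∂μ : ℝ) / 2 := by
    simp_rw [hsplit]
    rw [integral_add hre him, integral_mul_const, integral_complex_ofReal,
      integral_complex_ofReal, integral_const_mul, h0,
      integral_sub (integrable_const _) ((h2.const_mul _).div_const _), integral_div,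
      integral_const_mul]
    simp
  have hexp : Integrable (fun y => Complex.exp ((t * f y : ℝ) * Complex.I)) μ :=
    Integrable.of_bound (C := 1) (by have := hf.aestronglyMeasurable.aemeasurable; fun_prop)
      (Eventually.of_forall fun y => (Complex.norm_exp_ofReal_mul_I _).le)
  have hchar : charFun (μ.map f) t = ∫ y, Complex.exp ((t * f y : ℝ) * Complex.I) ∂μ := by
    rw [charFun_apply_real, integral_map hf.aestronglyMeasurable.aemeasurable (by fun_prop)]
    push_cast
    rfl
  rw [hchar, ← htaylor, ← integral_sub hexp
    ((integrable_congr (Eventually.of_forall hsplit)).2 (hre.add him)), ← integral_const_mul]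
  refine norm_integral_le_of_norm_le (h3.const_mul _) (Eventually.of_forall fun y => ?_)
  refine (norm_exp_mul_I_sub_taylor_le _).trans_eq ?_
  rw [abs_mul, mul_pow, mul_assoc]

theorem charFun_map_sum_pi_eq_pow (hf : AEMeasurable f μ) (n : ℕ) (t : ℝ) :
    charFun ((Measure.pi fun _ : Fin n => μ).map fun y => ∑ j, f (y j)) t
      = charFun (μ.map f) t ^ n := by
  have hmeas : AEMeasurable (fun (y : Fin n → E) j => f (y j)) (Measure.pi fun _ => μ) :=
    aemeasurable_pi_lambda _ fun j => hf.comp_quasiMeasurePreserving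
      (measurePreserving_eval _ j).quasiMeasurePreserving
  have hmap := Measure.pi_map_pi (μ := fun _ : Fin n => μ) (f := fun _ => f) fun _ => hf
  have := Measure.isProbabilityMeasure_map hf
  have hsum := charFun_map_sum_pi_eq_prod fun _ : Fin n => μ.map f
  rw [← hmap, AEMeasurable.map_map_of_aemeasurable (by fun_prop) hmeas] at hsum
  simpa [Function.comp_def] using congrFun hsum t

theorem tendstoInDistribution_sum_pi_gaussianReal {ι : Type*} {l : Filter ι}
    [l.IsCountablyGenerated] {E : ι → Type*} [∀ i, MeasurableSpace (E i)]
    {μ : (i : ι) → Measure (E i)} [∀ i, IsProbabilityMeasure (μ i)] {f : (i : ι) → E i → ℝ}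
    {n : ι → ℕ} {σ2 : ℝ≥0} (hmeas : ∀ i, AEMeasurable (f i) (μ i)) (hn : Tendsto n l atTop)
    (hf : ∀ᶠ i in l, MemLp (f i) 3 (μ i)) (hmean : ∀ᶠ i in l, ∫ y, f i y ∂(μ i) = 0)
    (hvar : Tendsto (fun i => n i * ∫ y, f i y ^ 2 ∂(μ i)) l (𝓝 σ2))
    (hthird : Tendsto (fun i => n i * ∫ y, |f i y| ^ 3 ∂(μ i)) l (𝓝 0)) :
    TendstoInDistribution (fun i (y : Fin (n i) → E i) => ∑ j, f i (y j)) l id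
      (fun i => Measure.pi fun _ => μ i) (gaussianReal 0 σ2) where
  forall_aemeasurable i := Finset.aemeasurable_fun_sum _ fun j _ =>
    (hmeas i).comp_quasiMeasurePreserving (measurePreserving_eval _ j).quasiMeasurePreserving
  tendsto := by
    refine tendsto_of_seq_tendsto fun s hs =>
      ProbabilityMeasure.tendsto_of_tendsto_charFun fun t => ?_
    refine Tendsto.comp (f := s) (g := fun i => charFun ((Measure.pi fun _ => μ i).map
      fun y : Fin (n i) → E i => ∑ j, f i (y j)) t) (y := l) ?_ hs
    simp only [ProbabilityMeasure.coe_mk, Measure.map_id, charFun_gaussianReal,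
      charFun_map_sum_pi_eq_pow (hmeas _)]
    refine tendsto_pow_exp_of_tendsto_mul_sub_one hn ?_
    have hmain : Tendsto (fun i => -((t ^ 2 * (n i * ∫ y, f i y ^ 2 ∂(μ i)) : ℝ) : ℂ) / 2) l
        (𝓝 (t * (0 : ℝ) * Complex.I - (σ2 : ℝ) * t ^ 2 / 2)) := by
      convert! ((hvar.const_mul (t ^ 2)).ofReal.neg.div_const 2) using 2
      push_cast
      ring
    refine hmain.congr_dist (squeeze_zero' (Eventually.of_forall fun _ => dist_nonneg) ?_
      (by simpa using hthird.const_mul (4 * |t| ^ 3)))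
    filter_upwards [hf, hmean] with i hfi hmi
    rw [dist_comm, dist_eq_norm]
    calc _ = ‖(n i : ℂ) * (charFun ((μ i).map (f i)) t
            - (1 - (t ^ 2 * ∫ y, f i y ^ 2 ∂(μ i) : ℝ) / 2))‖ := by
          push_cast
          ring_nf
      _ = n i * ‖charFun ((μ i).map (f i)) t
            - (1 - (t ^ 2 * ∫ y, f i y ^ 2 ∂(μ i) : ℝ) / 2)‖ := by
          rw [norm_mul, Complex.norm_natCast]
      _ ≤ n i * (4 * |t| ^ 3 * ∫ y, |f i y| ^ 3 ∂(μ i)) := by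
          gcongr
          exact norm_charFun_map_sub_taylor_le hfi hmi t
      _ = _ := by ring

end CentralLimit

section QuadraticExpansion

theorem abs_le_mul_abs_sub_pow_succ_of_hasDerivAt {f f' : ℝ → ℝ} {s : Set ℝ} (hs : Convex ℝ s)
    {M x y : ℝ} {k : ℕ} (hM : 0 ≤ M) (hf : ∀ z ∈ s, HasDerivAt f (f' z) z) (hx : x ∈ s)
    (hfx : f x = 0) (hf' : ∀ z ∈ s, |f' z| ≤ M * |z - x| ^ k) (hy : y ∈ s) :
    |f y| ≤ M * |y - x| ^ (k + 1) := by
  have hsub : segment ℝ x y ⊆ s := hs.segment_subset hx hy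
  have hbound : ∀ z ∈ segment ℝ x y, ‖f' z‖ ≤ M * |y - x| ^ k := fun z hz => by
    have hzx : |z - x| ≤ |y - x| := Set.abs_sub_left_of_mem_uIcc (segment_eq_uIcc x y ▸ hz)
    exact (hf' z (hsub hz)).trans
      (mul_le_mul_of_nonneg_left (pow_le_pow_left₀ (abs_nonneg _) hzx k) hM)
  have h := (convex_segment x y).norm_image_sub_le_of_norm_hasDerivWithin_le
    (fun z hz => (hf z (hsub hz)).hasDerivWithinAt) hbound (left_mem_segment ℝ x y)
    (right_mem_segment ℝ x y)
  rw [hfx, sub_zero, Real.norm_eq_abs, Real.norm_eq_abs] at h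
  rwa [pow_succ, ← mul_assoc]

theorem abs_sub_taylor_two_le {f f₁ f₂ f₃ : ℝ → ℝ} {s : Set ℝ} (hs : Convex ℝ s) {M : ℝ}
    (hf : ∀ z ∈ s, HasDerivAt f (f₁ z) z) (hf₁ : ∀ z ∈ s, HasDerivAt f₁ (f₂ z) z)
    (hf₂ : ∀ z ∈ s, HasDerivAt f₂ (f₃ z) z) (hM : ∀ z ∈ s, |f₃ z| ≤ M) {x y : ℝ} (hx : x ∈ s)
    (hy : y ∈ s) :
    |f y - f x - f₁ x * (y - x) - f₂ x * (y - x) ^ 2 / 2| ≤ M * |y - x| ^ 3 := by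
  have hM0 : 0 ≤ M := (abs_nonneg _).trans (hM x hx)
  have h₂ : ∀ z ∈ s, |f₂ z - f₂ x| ≤ M * |z - x| ^ 1 := fun z hz =>
    abs_le_mul_abs_sub_pow_succ_of_hasDerivAt hs hM0 (fun u hu => (hf₂ u hu).sub_const (f₂ x)) hx
      (sub_self _) (fun u hu => by simpa using hM u hu) hz
  have h₁ : ∀ z ∈ s, |f₁ z - f₁ x - f₂ x * (z - x)| ≤ M * |z - x| ^ 2 := fun z hz =>
    abs_le_mul_abs_sub_pow_succ_of_hasDerivAt
      (f := fun u => f₁ u - f₁ x - f₂ x * (u - x)) hs hM0 (fun u hu =>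
        (((hf₁ u hu).sub_const (f₁ x)).sub
          (((hasDerivAt_id u).sub_const x).const_mul (f₂ x))).congr_deriv (by ring))
      hx (by ring) h₂ hz
  refine abs_le_mul_abs_sub_pow_succ_of_hasDerivAt
    (f := fun u => f u - f x - f₁ x * (u - x) - f₂ x * (u - x) ^ 2 / 2) hs hM0 (fun u hu =>
      ((((hf u hu).sub_const (f x)).sub (((hasDerivAt_id u).sub_const x).const_mul (f₁ x))).sub
        (((((hasDerivAt_id u).sub_const x).pow 2).const_mul (f₂ x)).div_const 2)).congr_deriv ?_)
    hx (by ring) h₁ hy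
  simp only [id, Nat.cast_ofNat, Nat.add_one_sub_one, pow_one]
  ring

variable {E : Type*} [MeasurableSpace E] {μ : Measure E} [IsProbabilityMeasure μ]

theorem integrable_sum_pi {f : E → ℝ} (hf : Integrable f μ) (n : ℕ) :
    Integrable (fun y : Fin n → E => ∑ j, f (y j)) (Measure.pi fun _ => μ) :=
  integrable_finsetSum _ fun j _ =>
    (measurePreserving_eval (fun _ : Fin n => μ) j).integrable_comp_of_integrable hf

theorem integral_sum_pi {f : E → ℝ} (hf : Integrable f μ) (n : ℕ) :
    ∫ y : Fin n → E, ∑ j, f (y j) ∂(Measure.pi fun _ => μ) = n * ∫ y, f y ∂μ := by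
  refine (integral_finsetSum _ fun j _ =>
    (measurePreserving_eval (fun _ : Fin n => μ) j).integrable_comp_of_integrable hf).trans ?_
  simp only [Function.comp_apply, Function.eval,
    integral_comp_eval (μ := fun _ : Fin n => μ) hf.aestronglyMeasurable, Finset.sum_const,
    Finset.card_univ, Fintype.card_fin, nsmul_eq_mul]

theorem sq_integral_abs_le {X : E → ℝ} (hX : MemLp X 2 μ) :
    (∫ y, |X y| ∂μ) ^ 2 ≤ ∫ y, X y ^ 2 ∂μ := by
  have h := variance_nonneg |X| μ
  rw [variance_eq_sub hX.abs] at h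
  simpa only [Pi.pow_apply, Pi.abs_apply, sq_abs, sub_nonneg] using h

theorem integral_abs_sum_sub_pi_le {f : E → ℝ} (hf : MemLp f 2 μ) (n : ℕ) :
    ∫ y : Fin n → E, |∑ j, f (y j) - n * ∫ z, f z ∂μ| ∂(Measure.pi fun _ => μ)
      ≤ √(n * ∫ y, f y ^ 2 ∂μ) := by
  have hsum : MemLp (fun y : Fin n → E => ∑ j, f (y j)) 2 (Measure.pi fun _ => μ) :=
    memLp_finsetSum _ fun j _ =>
      hf.comp_measurePreserving (measurePreserving_eval (fun _ : Fin n => μ) j)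
  have hvar := variance_sum_pi (μ := fun _ : Fin n => μ) (X := fun _ => f) fun _ => hf
  rw [Finset.sum_const, Finset.card_univ, Fintype.card_fin, nsmul_eq_mul,
    variance_eq_integral (by simpa [Finset.sum_fn] using hsum.aestronglyMeasurable.aemeasurable)]
    at hvar
  simp only [Finset.sum_apply, integral_sum_pi (hf.integrable one_le_two)] at hvar
  refine Real.le_sqrt_of_sq_le ((sq_integral_abs_le (hsum.sub (memLp_const _))).trans ?_)
  refine hvar.trans_le ?_
  gcongr
  exact variance_le_expectation_sq hf.aestronglyMeasurable

theorem lintegral_enorm_sum_quadratic_expansion_le {g s s' ρ : E → ℝ} {δ : ℝ}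
    (hs' : MemLp s' 2 μ) (hρ : Integrable ρ μ)
    (hg : ∀ y, |g y - s y * δ - s' y * δ ^ 2 / 2| ≤ ρ y) (n : ℕ) (a : ℝ) :
    ∫⁻ y : Fin n → E, ‖∑ j, g (y j) - δ * ∑ j, s (y j) + a / 2‖ₑ ∂(Measure.pi fun _ => μ)
      ≤ ENNReal.ofReal (n * ∫ y, ρ y ∂μ + δ ^ 2 / 2 * √(n * ∫ y, s' y ^ 2 ∂μ)
        + |a + n * δ ^ 2 * ∫ y, s' y ∂μ| / 2) := by
  set V := ∫ y, s' y ∂μ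
  set G : (Fin n → E) → ℝ := fun y => ∑ j, ρ (y j) + δ ^ 2 / 2 * |∑ j, s' (y j) - n * V|
    + |a + n * δ ^ 2 * V| / 2
  have hle : ∀ y : Fin n → E, |∑ j, g (y j) - δ * ∑ j, s (y j) + a / 2| ≤ G y := fun y => by
    have hsplit : ∑ j, g (y j) - δ * ∑ j, s (y j) + a / 2
        = ∑ j, (g (y j) - s (y j) * δ - s' (y j) * δ ^ 2 / 2)
          + δ ^ 2 / 2 * (∑ j, s' (y j) - n * V) + (a + n * δ ^ 2 * V) / 2 := by
      simp only [Finset.sum_sub_distrib, ← Finset.sum_mul, ← Finset.sum_div]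
      ring
    rw [hsplit]
    refine (abs_add_three _ _ _).trans (add_le_add (add_le_add ?_ ?_) ?_)
    · exact (Finset.abs_sum_le_sum_abs _ _).trans (Finset.sum_le_sum fun j _ => hg (y j))
    · rw [abs_mul, abs_of_nonneg (by positivity : 0 ≤ δ ^ 2 / 2)]
    · rw [abs_div, abs_two]
  have hdev : Integrable (fun y : Fin n → E => δ ^ 2 / 2 * |∑ j, s' (y j) - n * V|)
      (Measure.pi fun _ => μ) :=
    ((integrable_sum_pi (hs'.integrable one_le_two) n).sub (integrable_const _)).abs.const_mul _
  have hsum : Integrable (fun y : Fin n → E =>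
      ∑ j, ρ (y j) + δ ^ 2 / 2 * |∑ j, s' (y j) - n * V|) (Measure.pi fun _ => μ) :=
    (integrable_sum_pi hρ n).add hdev
  have hG : Integrable G (Measure.pi fun _ => μ) := hsum.add (integrable_const _)
  calc _ ≤ ∫⁻ y, ENNReal.ofReal (G y) ∂(Measure.pi fun _ => μ) := lintegral_mono fun y => by
        rw [Real.enorm_eq_ofReal_abs]
        exact ENNReal.ofReal_le_ofReal (hle y)
    _ = ENNReal.ofReal (∫ y, G y ∂(Measure.pi fun _ => μ)) :=
        (ofReal_integral_eq_lintegral_ofReal hG (Eventually.of_forall fun y =>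
          (abs_nonneg _).trans (hle y))).symm
    _ ≤ _ := by
        refine ENNReal.ofReal_le_ofReal ?_
        rw [integral_add hsum (integrable_const _), integral_add (integrable_sum_pi hρ n) hdev,
          integral_sum_pi hρ, integral_const_mul, integral_const, probReal_univ, one_smul]
        gcongr
        exact integral_abs_sum_sub_pi_le hs' n

end QuadraticExpansion

theorem tendsto_measure_le_abs_of_tendsto_lintegral_enorm {ι : Type*} {l : Filter ι} {E : ι → Type*}
    [∀ i, MeasurableSpace (E i)] {μ : (i : ι) → Measure (E i)} {f : (i : ι) → E i → ℝ}
    (hf : ∀ i, AEMeasurable (f i) (μ i)) (h : Tendsto (fun i => ∫⁻ y, ‖f i y‖ₑ ∂(μ i)) l (𝓝 0))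
    {δ : ℝ} (hδ : 0 < δ) : Tendsto (fun i => μ i {y | δ ≤ |f i y|}) l (𝓝 0) := by
  have hδ' : ENNReal.ofReal δ ≠ 0 := (ENNReal.ofReal_pos.2 hδ).ne'
  refine tendsto_of_tendsto_of_tendsto_of_le_of_le tendsto_const_nhds
    (by simpa using ENNReal.Tendsto.div_const h (Or.inr hδ')) (fun i => zero_le) fun i => ?_
  refine (measure_mono fun y hy => ?_).trans
    (meas_ge_le_lintegral_div (hf i).enorm hδ' ENNReal.ofReal_ne_top)
  simpa only [Set.mem_ofPred_eq, Real.enorm_eq_ofReal_abs] using ENNReal.ofReal_le_ofReal hy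

theorem rnDeriv_ae_eq_div_singleton {E : Type*} [MeasurableSpace E] [Countable E]
    [MeasurableSingletonClass E] (μ ν : Measure E) [IsFiniteMeasure μ] (hμ : ∀ x, μ {x} ≠ 0) :
    ν.rnDeriv μ =ᵐ[μ] fun x => ν {x} / μ {x} := by
  have hdens : ν = μ.withDensity fun x => ν {x} / μ {x} := by
    refine Measure.ext_of_singleton fun x => ?_
    rw [withDensity_apply _ (measurableSet_singleton x), lintegral_singleton,
      ENNReal.div_mul_cancel (hμ x) (measure_ne_top μ _)]
  have hrn := Measure.rnDeriv_withDensity μ (f := fun x => ν {x} / μ {x})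
    (measurable_of_countable _)
  rwa [← hdens] at hrn

section Bessel

theorem summable_besselI (a : ℕ) (x : ℝ) :
    Summable fun m : ℕ => (x / 2) ^ (2 * m + a) / ((m ! : ℝ) * ((a + m)! : ℝ)) := by
  refine Summable.of_norm_bounded
    ((Real.summable_pow_div_factorial (|x / 2| ^ 2)).mul_left (|x / 2| ^ a)) fun m => ?_
  have hfact : (1 : ℝ) ≤ (a + m)! := mod_cast Nat.factorial_pos _
  calc ‖(x / 2) ^ (2 * m + a) / ((m ! : ℝ) * ((a + m)! : ℝ))‖
      = |x / 2| ^ (2 * m + a) / ((m ! : ℝ) * ((a + m)! : ℝ)) := by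
        rw [norm_div, norm_pow, Real.norm_eq_abs, Real.norm_of_nonneg (by positivity)]
    _ ≤ |x / 2| ^ (2 * m + a) / ((m ! : ℝ) * 1) := by gcongr
    _ = |x / 2| ^ a * ((|x / 2| ^ 2) ^ m / m !) := by ring

theorem besselI_nonneg (a : ℕ) {x : ℝ} (hx : 0 ≤ x) : 0 ≤ besselI a x :=
  tsum_nonneg fun _ => by positivity

theorem besselI_pos (a : ℕ) {x : ℝ} (hx : 0 < x) : 0 < besselI a x :=
  (summable_besselI a x).tsum_pos (fun m => by positivity) 0 (by positivity)

theorem besselI_mono (a : ℕ) {x y : ℝ} (hx : 0 ≤ x) (hxy : x ≤ y) : besselI a x ≤ besselI a y :=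
  (summable_besselI a x).tsum_le_tsum (fun m => by gcongr) (summable_besselI a y)

theorem pow_mul_besselI_le (a : ℕ) {x r : ℝ} (hx : 0 ≤ x) (hr : 1 ≤ r) :
    r ^ a * besselI a x ≤ besselI a (r * x) := by
  rw [besselI, besselI, ← tsum_mul_left]
  refine ((summable_besselI a x).mul_left _).tsum_le_tsum (fun m => ?_) (summable_besselI a _)
  rw [mul_div_assoc r x, mul_pow, mul_div_assoc]
  have hpow : r ^ a ≤ r ^ (2 * m + a) := pow_le_pow_right₀ hr (Nat.le_add_left _ _)
  gcongr

theorem besselI_recurrence (a : ℕ) (x : ℝ) :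
    (a + 1) * besselI (a + 1) x + x / 2 * besselI (a + 2) x = x / 2 * besselI a x := by
  have hshift : HasSum (fun m : ℕ => m * ((x / 2) ^ (2 * m + (a + 1)) / (m ! * (a + 1 + m)! : ℝ)))
      (x / 2 * besselI (a + 2) x) := by
    rw [← hasSum_nat_add_iff' 1]
    simp only [Finset.range_one, Finset.sum_singleton, Nat.cast_zero, zero_mul, sub_zero]
    refine ((summable_besselI (a + 2) x).hasSum.mul_left (x / 2)).congr_fun fun m => ?_
    rw [show a + 1 + (m + 1) = a + 2 + m by ring, Nat.factorial_succ m]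
    push_cast
    field_simp
    ring
  refine (((summable_besselI (a + 1) x).hasSum.mul_left (a + 1 : ℝ)).add hshift).unique
    (((summable_besselI a x).hasSum.mul_left (x / 2)).congr_fun fun m => ?_)
  rw [show a + 1 + m = a + m + 1 by ring, Nat.factorial_succ (a + m)]
  push_cast
  field_simp
  ring

theorem besselI_succ_le (a : ℕ) {x : ℝ} (hx : 0 ≤ x) :
    besselI (a + 1) x ≤ x / 2 * besselI a x := by
  rw [← besselI_recurrence]
  have h1 : 0 ≤ a * besselI (a + 1) x := mul_nonneg a.cast_nonneg (besselI_nonneg _ hx)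
  have h2 : 0 ≤ x / 2 * besselI (a + 2) x := mul_nonneg (by positivity) (besselI_nonneg _ hx)
  linarith

end Bessel

/-- The average of the two neighbouring values of a function on `ℤ`, i.e. the transition operator
of the simple symmetric random walk. -/
noncomputable def neighborMean (f : ℤ → ℝ) (k : ℤ) : ℝ := (f (k - 1) + f (k + 1)) / 2

/-- The generator `L - 1` of the rate-one simple symmetric random walk on `ℤ` in continuous time,
where `L` is `neighborMean`. -/
noncomputable def walkGenerator (f : ℤ → ℝ) (k : ℤ) : ℝ := neighborMean f k - f k

/-- The probability that the sum of `d` independent symmetric signs equals `k`. -/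
noncomputable def walkProb : ℕ → ℤ → ℝ
  | 0 => Pi.single 0 1
  | d + 1 => neighborMean (walkProb d)

/-- The probability mass function of the symmetric Skellam distribution, the law of a compound
Poisson variable with jumps `±1` and a mean number `x` of jumps. -/
noncomputable def skellamPMF (x : ℝ) (k : ℤ) : ℝ := Real.exp (-x) * besselI k.natAbs x

section Walk

theorem neighborMean_nonneg {f : ℤ → ℝ} (hf : ∀ k, 0 ≤ f k) (k : ℤ) : 0 ≤ neighborMean f k :=
  div_nonneg (add_nonneg (hf _) (hf _)) zero_le_two

theorem hasSum_neighborMean {f : ℤ → ℝ} {a : ℝ} (hf : HasSum f a) : HasSum (neighborMean f) a := by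
  have h := (((Equiv.subRight (1 : ℤ)).hasSum_iff.2 hf).add
    ((Equiv.addRight (1 : ℤ)).hasSum_iff.2 hf)).div_const 2
  rwa [add_self_div_two] at h

theorem hasSum_walkGenerator {f : ℤ → ℝ} (hf : Summable f) : HasSum (walkGenerator f) 0 := by
  simpa only [sub_self] using! (hasSum_neighborMean hf.hasSum).sub hf.hasSum

theorem hasDerivAt_walkGenerator {f : ℝ → ℤ → ℝ} {f' : ℤ → ℝ} {x : ℝ}
    (h : ∀ k, HasDerivAt (fun x => f x k) (f' k) x) (k : ℤ) :
    HasDerivAt (fun x => walkGenerator (f x) k) (walkGenerator f' k) x :=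
  (((h (k - 1)).add (h (k + 1))).div_const 2).sub (h k)

theorem walkProb_nonneg (d : ℕ) (k : ℤ) : 0 ≤ walkProb d k := by
  induction d generalizing k with
  | zero => exact (Pi.single_nonneg.2 zero_le_one : (0 : ℤ → ℝ) ≤ Pi.single 0 1) k
  | succ d ih => exact neighborMean_nonneg ih k

theorem hasSum_walkProb (d : ℕ) : HasSum (walkProb d) 1 := by
  induction d with
  | zero => exact hasSum_pi_single 0 1
  | succ d ih => exact hasSum_neighborMean ih

theorem walkProb_le_one (d : ℕ) (k : ℤ) : walkProb d k ≤ 1 :=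
  le_hasSum (hasSum_walkProb d) k fun _ _ => walkProb_nonneg d _

theorem walkProb_eq_zero {d : ℕ} {k : ℤ} (h : ∀ a c : ℕ, a + c = d → k ≠ a - c) :
    walkProb d k = 0 := by
  induction d generalizing k with
  | zero => exact Pi.single_eq_of_ne (by simpa using h 0 0 rfl) 1
  | succ d ih =>
    rw [walkProb, neighborMean, ih, ih, add_zero, zero_div]
    · exact fun a c hac hk => h a (c + 1) (by omega) (by push_cast; omega)
    · exact fun a c hac hk => h (a + 1) c (by omega) (by push_cast; omega)

theorem walkProb_add_sub (a c : ℕ) :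
    walkProb (a + c) (a - c) = (a + c).choose c / 2 ^ (a + c) := by
  induction hd : a + c generalizing a c with
  | zero =>
    obtain ⟨rfl, rfl⟩ : a = 0 ∧ c = 0 := by omega
    simp [walkProb]
  | succ d ih =>
    have hup : ∀ a' : ℕ, a = a' + 1 → walkProb d (a - c - 1) = d.choose c / 2 ^ d := by
      rintro a' rfl
      rw [← ih a' c (by omega)]
      congr 1
      push_cast
      ring
    have hdown : ∀ c' : ℕ, c = c' + 1 → walkProb d (a - c + 1) = d.choose c' / 2 ^ d := by
      rintro c' rfl
      rw [← ih a c' (by omega)]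
      congr 1
      push_cast
      ring
    rw [walkProb, neighborMean]
    rcases a with _ | a <;> rcases c with _ | c
    · omega
    · obtain rfl : c = d := by omega
      rw [walkProb_eq_zero (fun a c hac hk => by omega), hdown c rfl, Nat.choose_self,
        Nat.choose_self]
      ring
    · rw [hup a rfl, walkProb_eq_zero (fun a c hac hk => by omega), Nat.choose_zero_right,
        Nat.choose_zero_right]
      ring
    · rw [hup a rfl, hdown c rfl, Nat.choose_succ_succ]
      push_cast
      ring

theorem walkProb_two_mul_add_natAbs (m : ℕ) (k : ℤ) :
    walkProb (2 * m + k.natAbs) k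
      = (2 * m + k.natAbs).choose m / 2 ^ (2 * m + k.natAbs) := by
  rcases Int.natAbs_eq k with h | h
  · rw [show 2 * m + k.natAbs = m + k.natAbs + m by ring, ← walkProb_add_sub (m + k.natAbs) m]
    exact congrArg _ (by omega)
  · rw [show 2 * m + k.natAbs = m + (m + k.natAbs) by ring, Nat.choose_symm_add,
      ← walkProb_add_sub m (m + k.natAbs)]
    exact congrArg _ (by omega)

theorem hasSum_walkProb_mul_pow_div_factorial (x : ℝ) (k : ℤ) :
    HasSum (fun d : ℕ => walkProb d k * (x ^ d / d !)) (besselI k.natAbs x) := by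
  have hinj : Function.Injective fun m : ℕ => 2 * m + k.natAbs := fun m m' h => by
    simp only at h
    omega
  rw [← hinj.hasSum_iff]
  · refine (summable_besselI k.natAbs x).hasSum.congr_fun fun m => ?_
    rw [Function.comp_apply, walkProb_two_mul_add_natAbs, Nat.cast_choose ℝ (by omega),
      show 2 * m + k.natAbs - m = k.natAbs + m by omega, div_pow]
    field_simp
  · intro d hd
    rw [walkProb_eq_zero, zero_mul]
    rintro a c hac hk
    refine hd ⟨min a c, ?_⟩
    simp only
    omega

end Walk

theorem hasDerivAt_tsum_mul_pow_div_factorial {a : ℕ → ℝ} {M : ℝ} (ha : ∀ d, |a d| ≤ M) (x : ℝ) :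
    HasDerivAt (fun x => ∑' d, a d * (x ^ d / d !)) (∑' d, a (d + 1) * (x ^ d / d !)) x := by
  have hM : 0 ≤ M := (abs_nonneg _).trans (ha 0)
  have hsum : ∀ y : ℝ, Summable fun d => a d * (y ^ d / d !) := fun y =>
    Summable.of_norm_bounded ((Real.summable_pow_div_factorial |y|).mul_left M) fun d => by
      rw [norm_mul, norm_div, norm_pow, RCLike.norm_natCast, Real.norm_eq_abs, Real.norm_eq_abs]
      exact mul_le_mul_of_nonneg_right (ha d) (by positivity)
  have hderiv : ∀ (d : ℕ) (y : ℝ), (d + 1 : ℕ) * y ^ d / (d + 1)! = y ^ d / d ! := fun d y => by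
    rw [Nat.factorial_succ]
    push_cast
    field_simp
  have hbound : Summable fun d : ℕ => M * (d * (|x| + 1) ^ (d - 1) / d !) := by
    rw [← summable_nat_add_iff 1]
    simp only [Nat.add_sub_cancel, hderiv]
    exact (Real.summable_pow_div_factorial (|x| + 1)).mul_left M
  have hle : ∀ (d : ℕ), ∀ y ∈ Metric.ball (0 : ℝ) (|x| + 1),
      ‖a d * (d * y ^ (d - 1) / d !)‖ ≤ M * (d * (|x| + 1) ^ (d - 1) / d !) := fun d y hy => by
    have hy' : |y| ≤ |x| + 1 := (mem_ball_zero_iff.1 hy).le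
    rw [norm_mul, norm_div, norm_mul, norm_pow, RCLike.norm_natCast, RCLike.norm_natCast,
      Real.norm_eq_abs, Real.norm_eq_abs]
    gcongr
    exact ha d
  have hx : x ∈ Metric.ball (0 : ℝ) (|x| + 1) := by simp
  refine (hasDerivAt_tsum_of_isPreconnected hbound Metric.isOpen_ball
    (convex_ball (0 : ℝ) (|x| + 1)).isPreconnected
    (fun d y _ => ((hasDerivAt_pow d y).div_const (d ! : ℝ)).const_mul (a d)) hle hx (hsum x)
    hx).congr_deriv ?_
  rw [(Summable.of_norm_bounded hbound fun d => hle d x hx).tsum_eq_zero_add]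
  simp only [Nat.cast_zero, zero_mul, zero_div, mul_zero, zero_add, Nat.add_sub_cancel, hderiv]

theorem hasDerivAt_besselI_natAbs (k : ℤ) (x : ℝ) :
    HasDerivAt (besselI k.natAbs) (neighborMean (fun k => besselI k.natAbs x) k) x := by
  have h := hasDerivAt_tsum_mul_pow_div_factorial (a := fun d => walkProb d k) (M := 1)
    (fun d => (abs_of_nonneg (walkProb_nonneg d k)).trans_le (walkProb_le_one d k)) x
  simp only [(hasSum_walkProb_mul_pow_div_factorial _ k).tsum_eq] at h
  refine h.congr_deriv (HasSum.tsum_eq ?_)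
  refine (((hasSum_walkProb_mul_pow_div_factorial x (k - 1)).add
    (hasSum_walkProb_mul_pow_div_factorial x (k + 1))).div_const 2).congr_fun fun d => ?_
  rw [walkProb, neighborMean]
  ring

/-- The symmetric Skellam distribution with parameter `x`; for `x < 0` it is the one with parameter
`0`, so that it is a probability measure for every real `x`. -/
noncomputable def skellamMeasure (x : ℝ) : Measure ℤ :=
  Measure.sum fun k => ENNReal.ofReal (skellamPMF (max x 0) k) • Measure.dirac k

section Skellam

theorem skellamPMF_nonneg {x : ℝ} (hx : 0 ≤ x) (k : ℤ) : 0 ≤ skellamPMF x k :=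
  mul_nonneg (Real.exp_nonneg _) (besselI_nonneg _ hx)

theorem skellamPMF_pos {x : ℝ} (hx : 0 < x) (k : ℤ) : 0 < skellamPMF x k :=
  mul_pos (Real.exp_pos _) (besselI_pos _ hx)

theorem hasDerivAt_skellamPMF (k : ℤ) (x : ℝ) :
    HasDerivAt (fun x => skellamPMF x k) (walkGenerator (skellamPMF x) k) x := by
  refine ((hasDerivAt_neg x).exp.mul (hasDerivAt_besselI_natAbs k x)).congr_deriv ?_
  simp only [walkGenerator, neighborMean, skellamPMF]
  ring

theorem lintegral_walkProb_poissonMeasure (r : ℝ≥0) (k : ℤ) :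
    ∫⁻ d, ENNReal.ofReal (walkProb d k) ∂(poissonMeasure r)
      = ENNReal.ofReal (skellamPMF r k) := by
  have h : HasSum (fun d : ℕ => walkProb d k * (Real.exp (-r) * r ^ d / d !)) (skellamPMF r k) :=
    ((hasSum_walkProb_mul_pow_div_factorial r k).mul_left (Real.exp (-r))).congr_fun fun d => by
      ring
  rw [lintegral_countable', ← h.tsum_eq, ENNReal.ofReal_tsum_of_nonneg
    (fun d => mul_nonneg (walkProb_nonneg d k) (by positivity)) h.summable]
  refine tsum_congr fun d => ?_
  rw [poissonMeasure_singleton, ENNReal.ofReal_mul (walkProb_nonneg d k)]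

theorem hasSum_skellamPMF {x : ℝ} (hx : 0 ≤ x) : HasSum (skellamPMF x) 1 := by
  have htsum : ∑' k, ENNReal.ofReal (skellamPMF x k) = 1 := by
    lift x to ℝ≥0 using hx
    have hwalk : ∀ d, ∑' k, ENNReal.ofReal (walkProb d k) = 1 := fun d => by
      rw [← ENNReal.ofReal_tsum_of_nonneg (walkProb_nonneg d) (hasSum_walkProb d).summable,
        (hasSum_walkProb d).tsum_eq, ENNReal.ofReal_one]
    simp_rw [← lintegral_walkProb_poissonMeasure]
    rw [← lintegral_tsum fun k => (measurable_of_countable _).aemeasurable]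
    simp only [hwalk, lintegral_one, measure_univ]
  have hsum : Summable (skellamPMF x) :=
    (ENNReal.summable_toReal (htsum.trans_ne ENNReal.one_ne_top)).congr fun k =>
      ENNReal.toReal_ofReal (skellamPMF_nonneg hx k)
  rw [← ENNReal.ofReal_tsum_of_nonneg (skellamPMF_nonneg hx) hsum, ENNReal.ofReal_eq_one] at htsum
  exact htsum ▸ hsum.hasSum

instance (x : ℝ) : IsProbabilityMeasure (skellamMeasure x) :=
  (hasSum_skellamPMF (le_max_right x 0)).isProbabilityMeasure_sum_dirac
    (skellamPMF_nonneg (le_max_right x 0))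

theorem skellamMeasure_singleton {x : ℝ} (hx : 0 ≤ x) (k : ℤ) :
    skellamMeasure x {k} = ENNReal.ofReal (skellamPMF x k) := by
  rw [skellamMeasure, max_eq_left hx]
  exact Measure.sum_smul_dirac_singleton

theorem integrable_skellamMeasure_iff {x : ℝ} (hx : 0 ≤ x) {f : ℤ → ℝ} :
    Integrable f (skellamMeasure x) ↔ Summable fun k => skellamPMF x k * |f k| := by
  rw [skellamMeasure, max_eq_left hx, integrable_sum_dirac_iff (by simp)]
  simp_rw [ENNReal.toReal_ofReal (skellamPMF_nonneg hx _), Real.norm_eq_abs]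

theorem hasSum_integral_skellamMeasure {x : ℝ} (hx : 0 ≤ x) {f : ℤ → ℝ}
    (hf : Integrable f (skellamMeasure x)) :
    HasSum (fun k => skellamPMF x k * f k) (∫ k, f k ∂(skellamMeasure x)) := by
  have hsum := (integrable_skellamMeasure_iff hx).1 hf
  have h := hasSum_integral_sum_dirac (f := f) (c := fun k => ENNReal.ofReal (skellamPMF x k))
    (x := fun k : ℤ => k) (by simp)
    (by simpa only [ENNReal.toReal_ofReal (skellamPMF_nonneg hx _), Real.norm_eq_abs] using hsum)
  rw [skellamMeasure, max_eq_left hx]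
  simpa only [ENNReal.toReal_ofReal (skellamPMF_nonneg hx _), smul_eq_mul] using! h

end Skellam

/-- The weight `1 + |k|`, whose powers bound the score of the Skellam family and its
derivatives. -/
def absWeight (k : ℤ) : ℝ := 1 + k.natAbs

section Moments

theorem one_le_absWeight (k : ℤ) : 1 ≤ absWeight k := le_add_of_nonneg_right (Nat.cast_nonneg _)

theorem absWeight_pos (k : ℤ) : 0 < absWeight k := zero_lt_one.trans_le (one_le_absWeight k)

theorem absWeight_le_two_mul {k l : ℤ} (h : l.natAbs ≤ k.natAbs + 1) :
    absWeight l ≤ 2 * absWeight k := by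
  have hl : (l.natAbs : ℝ) ≤ k.natAbs + 1 := mod_cast h
  unfold absWeight
  linarith

theorem absWeight_pow_le_exp (j : ℕ) (k : ℤ) :
    absWeight k ^ j ≤ j ! * Real.exp 1 * Real.exp 1 ^ k.natAbs := by
  have h := Real.pow_div_factorial_le_exp (absWeight k) (absWeight_pos k).le j
  rw [div_le_iff₀ (by positivity)] at h
  refine h.trans_eq ?_
  rw [absWeight, Real.exp_add, ← Real.exp_nat_mul, mul_one]
  ring

theorem skellamPMF_mul_absWeight_pow_le (j : ℕ) {x C : ℝ} (hx : x ∈ Set.Icc 0 C) (k : ℤ) :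
    skellamPMF x k * absWeight k ^ j
      ≤ j ! * Real.exp 1 * Real.exp (Real.exp 1 * C) * skellamPMF (Real.exp 1 * C) k := by
  have hB := besselI_nonneg k.natAbs hx.1
  have hp : skellamPMF x k ≤ besselI k.natAbs x :=
    mul_le_of_le_one_left hB (Real.exp_le_one_iff.2 (neg_nonpos.2 hx.1))
  have hpow := pow_mul_besselI_le k.natAbs hx.1 (Real.one_le_exp zero_le_one)
  have hmono : besselI k.natAbs (Real.exp 1 * x) ≤ besselI k.natAbs (Real.exp 1 * C) :=
    besselI_mono _ (mul_nonneg (Real.exp_nonneg 1) hx.1)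
      (mul_le_mul_of_nonneg_left hx.2 (Real.exp_nonneg 1))
  calc skellamPMF x k * absWeight k ^ j
      ≤ besselI k.natAbs x * (j ! * Real.exp 1 * Real.exp 1 ^ k.natAbs) :=
        mul_le_mul hp (absWeight_pow_le_exp j k) (pow_nonneg (absWeight_pos k).le j) hB
    _ = j ! * Real.exp 1 * (Real.exp 1 ^ k.natAbs * besselI k.natAbs x) := by ring
    _ ≤ j ! * Real.exp 1 * besselI k.natAbs (Real.exp 1 * C) := by
        gcongr
        exact hpow.trans hmono
    _ = j ! * Real.exp 1 * Real.exp (Real.exp 1 * C) * skellamPMF (Real.exp 1 * C) k := by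
        rw [skellamPMF, Real.exp_neg]
        field_simp

theorem integrable_of_abs_le_absWeight_pow {x : ℝ} (hx : 0 ≤ x) {f : ℤ → ℝ} {K : ℝ} {j : ℕ}
    (hf : ∀ k, |f k| ≤ K * absWeight k ^ j) : Integrable f (skellamMeasure x) := by
  have hK : 0 ≤ K := by simpa [absWeight] using (abs_nonneg _).trans (hf 0)
  rw [integrable_skellamMeasure_iff hx]
  refine Summable.of_nonneg_of_le
    (fun k => mul_nonneg (skellamPMF_nonneg hx k) (abs_nonneg _)) (fun k => ?_)
    (((hasSum_skellamPMF (mul_nonneg (Real.exp_nonneg 1) hx)).summable.mul_left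
      (j ! * Real.exp 1 * Real.exp (Real.exp 1 * x))).mul_left K)
  calc skellamPMF x k * |f k| ≤ skellamPMF x k * (K * absWeight k ^ j) :=
        mul_le_mul_of_nonneg_left (hf k) (skellamPMF_nonneg hx k)
    _ = K * (skellamPMF x k * absWeight k ^ j) := by ring
    _ ≤ _ := mul_le_mul_of_nonneg_left
        (skellamPMF_mul_absWeight_pow_le j (Set.right_mem_Icc.2 hx) k) hK

theorem integrable_absWeight_pow {x : ℝ} (hx : 0 ≤ x) (j : ℕ) :
    Integrable (fun k => absWeight k ^ j) (skellamMeasure x) :=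
  integrable_of_abs_le_absWeight_pow hx fun k => by
    rw [abs_of_nonneg (pow_nonneg (absWeight_pos k).le j), one_mul]

theorem integral_absWeight_pow_le (j : ℕ) {x C : ℝ} (hx : x ∈ Set.Icc 0 C) :
    ∫ k, absWeight k ^ j ∂(skellamMeasure x)
      ≤ j ! * Real.exp 1 * Real.exp (Real.exp 1 * C) := by
  have hC : 0 ≤ Real.exp 1 * C := mul_nonneg (Real.exp_nonneg 1) (hx.1.trans hx.2)
  have hdom := (hasSum_skellamPMF hC).mul_left (j ! * Real.exp 1 * Real.exp (Real.exp 1 * C))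
  rw [mul_one] at hdom
  exact hasSum_le (skellamPMF_mul_absWeight_pow_le j hx)
    (hasSum_integral_skellamMeasure hx.1 (integrable_absWeight_pow hx.1 j)) hdom

theorem exists_integral_abs_le_of_abs_le_absWeight_pow {s : Set ℝ} {C K : ℝ} {j : ℕ}
    (hs : s ⊆ Set.Icc 0 C) {f : ℝ → ℤ → ℝ} (hf : ∀ x ∈ s, ∀ k, |f x k| ≤ K * absWeight k ^ j) :
    ∃ M, ∀ x ∈ s, ∫ k, |f x k| ∂(skellamMeasure x) ≤ M := by
  refine ⟨K * (j ! * Real.exp 1 * Real.exp (Real.exp 1 * C)), fun x hx => ?_⟩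
  have hK : 0 ≤ K := by simpa [absWeight] using (abs_nonneg _).trans (hf x hx 0)
  have hx0 := (hs hx).1
  calc ∫ k, |f x k| ∂(skellamMeasure x) ≤ ∫ k, K * absWeight k ^ j ∂(skellamMeasure x) :=
        integral_mono (integrable_of_abs_le_absWeight_pow hx0 (hf x hx)).abs
          ((integrable_absWeight_pow hx0 j).const_mul K) (hf x hx)
    _ = K * ∫ k, absWeight k ^ j ∂(skellamMeasure x) := integral_const_mul _ _
    _ ≤ _ := mul_le_mul_of_nonneg_left (integral_absWeight_pow_le j (hs hx)) hK

end Moments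

/-- The ratio `∂ₓ^j p / p` for the Skellam probability mass function `p`; the derivative in the
parameter `x` is written as the walk generator in the space variable. -/
noncomputable def derivRatio (j : ℕ) (x : ℝ) (k : ℤ) : ℝ :=
  walkGenerator^[j] (skellamPMF x) k / skellamPMF x k

/-- The score `∂ₓ log p` of the Skellam family. -/
noncomputable def score (x : ℝ) (k : ℤ) : ℝ := derivRatio 1 x k

/-- The second logarithmic derivative `∂ₓ² log p` of the Skellam family. -/
noncomputable def scoreDeriv (x : ℝ) (k : ℤ) : ℝ := derivRatio 2 x k - score x k ^ 2

/-- The third logarithmic derivative `∂ₓ³ log p` of the Skellam family. -/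
noncomputable def scoreDerivTwo (x : ℝ) (k : ℤ) : ℝ :=
  derivRatio 3 x k - score x k * derivRatio 2 x k - 2 * score x k * scoreDeriv x k

/-- The Fisher information of the Skellam family. -/
noncomputable def fisherInfo (x : ℝ) : ℝ := ∫ k, score x k ^ 2 ∂(skellamMeasure x)

section Derivatives

theorem hasDerivAt_iterate_walkGenerator_skellamPMF (j : ℕ) (k : ℤ) (x : ℝ) :
    HasDerivAt (fun x => walkGenerator^[j] (skellamPMF x) k)
      (walkGenerator^[j + 1] (skellamPMF x) k) x := by
  induction j generalizing k with
  | zero => exact hasDerivAt_skellamPMF k x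
  | succ j ih =>
    simp only [Function.iterate_succ_apply' walkGenerator] at ih ⊢
    exact hasDerivAt_walkGenerator ih k

theorem hasDerivAt_derivRatio (j : ℕ) (k : ℤ) {x : ℝ} (hx : 0 < x) :
    HasDerivAt (fun x => derivRatio j x k)
      (derivRatio (j + 1) x k - score x k * derivRatio j x k) x := by
  have hp := (skellamPMF_pos hx k).ne'
  refine ((hasDerivAt_iterate_walkGenerator_skellamPMF j k x).div
    (hasDerivAt_skellamPMF k x) hp).congr_deriv ?_
  simp only [derivRatio, score, Function.iterate_one]
  field_simp

theorem hasDerivAt_log_skellamPMF (k : ℤ) {x : ℝ} (hx : 0 < x) :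
    HasDerivAt (fun x => Real.log (skellamPMF x k)) (score x k) x :=
  (hasDerivAt_skellamPMF k x).log (skellamPMF_pos hx k).ne'

theorem hasDerivAt_score (k : ℤ) {x : ℝ} (hx : 0 < x) :
    HasDerivAt (fun x => score x k) (scoreDeriv x k) x :=
  (hasDerivAt_derivRatio 1 k hx).congr_deriv (by rw [scoreDeriv, sq, score])

theorem hasDerivAt_scoreDeriv (k : ℤ) {x : ℝ} (hx : 0 < x) :
    HasDerivAt (fun x => scoreDeriv x k) (scoreDerivTwo x k) x :=
  ((hasDerivAt_derivRatio 2 k hx).sub ((hasDerivAt_score k hx).pow 2)).congr_deriv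
    (by rw [scoreDerivTwo, Nat.cast_ofNat, Nat.add_one_sub_one, pow_one])

end Derivatives

section Bounds

theorem neighborMean_skellamPMF (k : ℤ) {x : ℝ} (hx : 0 < x) :
    neighborMean (skellamPMF x) k
      = Real.exp (-x) * (besselI (k.natAbs + 1) x + k.natAbs / x * besselI k.natAbs x) := by
  have hmean : ∀ a : ℕ, (besselI a x + besselI (a + 2) x) / 2
      = besselI (a + 2) x + (a + 1 : ℕ) / x * besselI (a + 1) x := fun a => by
    have h := besselI_recurrence a x
    push_cast
    field_simp at h ⊢
    linarith
  have hsum : (besselI (k - 1).natAbs x + besselI (k + 1).natAbs x) / 2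
      = besselI (k.natAbs + 1) x + k.natAbs / x * besselI k.natAbs x := by
    rcases hk : k.natAbs with _ | a
    · obtain rfl : k = 0 := Int.natAbs_eq_zero.1 hk
      simp
    · rw [← hmean a]
      rcases Int.natAbs_eq k with h | h
      · rw [show (k - 1).natAbs = a by omega, show (k + 1).natAbs = a + 2 by omega]
      · rw [show (k - 1).natAbs = a + 2 by omega, show (k + 1).natAbs = a by omega, add_comm]
  rw [← hsum, neighborMean, skellamPMF, skellamPMF]
  ring

theorem score_eq_besselI_div (k : ℤ) {x : ℝ} (hx : 0 < x) :
    score x k = besselI (k.natAbs + 1) x / besselI k.natAbs x + x⁻¹ * |(k : ℝ)| - 1 := by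
  have hB := (besselI_pos k.natAbs hx).ne'
  rw [score, derivRatio, Function.iterate_one, walkGenerator, neighborMean_skellamPMF k hx,
    skellamPMF, ← Int.cast_abs, ← Nat.cast_natAbs]
  field_simp

theorem neighborMean_skellamPMF_le {c C x : ℝ} (hc : 0 < c) (hx : x ∈ Set.Icc c C) (k : ℤ) :
    neighborMean (skellamPMF x) k ≤ (C + c⁻¹) * absWeight k * skellamPMF x k := by
  have hx0 : 0 < x := hc.trans_le hx.1
  have hB := besselI_nonneg k.natAbs hx0.le
  have hup : x / 2 ≤ C * absWeight k :=
    (half_le_self hx0.le).trans (hx.2.trans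
      (le_mul_of_one_le_right (hx0.le.trans hx.2) (one_le_absWeight k)))
  have hdown : k.natAbs / x ≤ c⁻¹ * absWeight k := by
    rw [div_eq_inv_mul]
    exact mul_le_mul (inv_anti₀ hc hx.1) (le_add_of_nonneg_left zero_le_one)
      (Nat.cast_nonneg _) (inv_nonneg.2 hc.le)
  rw [neighborMean_skellamPMF k hx0, skellamPMF, mul_left_comm]
  refine mul_le_mul_of_nonneg_left ?_ (Real.exp_nonneg _)
  calc besselI (k.natAbs + 1) x + k.natAbs / x * besselI k.natAbs x
      ≤ x / 2 * besselI k.natAbs x + k.natAbs / x * besselI k.natAbs x := by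
        gcongr
        exact besselI_succ_le _ hx0.le
    _ ≤ C * absWeight k * besselI k.natAbs x + c⁻¹ * absWeight k * besselI k.natAbs x := by
        gcongr
    _ = _ := by ring

theorem skellamPMF_neighbor_le {c C x : ℝ} (hc : 0 < c) (hx : x ∈ Set.Icc c C) (k : ℤ) :
    skellamPMF x (k - 1) ≤ 2 * (C + c⁻¹) * absWeight k * skellamPMF x k ∧
      skellamPMF x (k + 1) ≤ 2 * (C + c⁻¹) * absWeight k * skellamPMF x k := by
  have hx0 : 0 ≤ x := hc.le.trans hx.1
  have h := neighborMean_skellamPMF_le hc hx k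
  have hleft := skellamPMF_nonneg hx0 (k - 1)
  have hright := skellamPMF_nonneg hx0 (k + 1)
  unfold neighborMean at h
  constructor <;> linarith

theorem abs_walkGenerator_le {c C x M : ℝ} (hc : 0 < c) (hx : x ∈ Set.Icc c C) (hM : 0 ≤ M)
    {f : ℤ → ℝ} {j : ℕ} (hf : ∀ k, |f k| ≤ M * absWeight k ^ j * skellamPMF x k) (k : ℤ) :
    |walkGenerator f k|
      ≤ M * (2 ^ j * (2 * (C + c⁻¹)) + 1) * absWeight k ^ (j + 1) * skellamPMF x k := by
  have hx0 : 0 ≤ x := hc.le.trans hx.1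
  have hw := (absWeight_pos k).le
  have hp := skellamPMF_nonneg hx0 k
  have hneighbor : ∀ l : ℤ, l.natAbs ≤ k.natAbs + 1 →
      skellamPMF x l ≤ 2 * (C + c⁻¹) * absWeight k * skellamPMF x k →
      |f l| ≤ M * (2 ^ j * (2 * (C + c⁻¹))) * absWeight k ^ (j + 1) * skellamPMF x k := by
    intro l hl hpl
    have hwl := (absWeight_pos l).le
    calc |f l| ≤ M * absWeight l ^ j * skellamPMF x l := hf l
      _ ≤ M * (2 * absWeight k) ^ j * (2 * (C + c⁻¹) * absWeight k * skellamPMF x k) := by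
          refine mul_le_mul ?_ hpl (skellamPMF_nonneg hx0 l) (by positivity)
          gcongr
          exact absWeight_le_two_mul hl
      _ = _ := by ring
  have hself : |f k| ≤ M * absWeight k ^ (j + 1) * skellamPMF x k := by
    refine (hf k).trans ?_
    gcongr
    · exact one_le_absWeight k
    · exact j.le_succ
  have hleft := hneighbor (k - 1) (by omega) (skellamPMF_neighbor_le hc hx k).1
  have hright := hneighbor (k + 1) (by omega) (skellamPMF_neighbor_le hc hx k).2
  calc |walkGenerator f k| ≤ (|f (k - 1)| + |f (k + 1)|) / 2 + |f k| := by
        refine (abs_sub _ _).trans (add_le_add_left ?_ _)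
        rw [neighborMean, abs_div, abs_two]
        gcongr
        exact abs_add_le _ _
    _ ≤ _ := by linarith

theorem exists_abs_derivRatio_le {c : ℝ} (hc : 0 < c) (C : ℝ) (j : ℕ) :
    ∃ K, 0 ≤ K ∧ ∀ x ∈ Set.Icc c C, ∀ k, |derivRatio j x k| ≤ K * absWeight k ^ j := by
  suffices h : ∃ K, 0 ≤ K ∧ ∀ x ∈ Set.Icc c C, ∀ k,
      |walkGenerator^[j] (skellamPMF x) k| ≤ K * absWeight k ^ j * skellamPMF x k by
    obtain ⟨K, hK, h⟩ := h
    refine ⟨K, hK, fun x hx k => ?_⟩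
    have hp := skellamPMF_pos (hc.trans_le hx.1) k
    rw [derivRatio, abs_div, abs_of_pos hp, div_le_iff₀ hp]
    exact h x hx k
  induction j with
  | zero => exact ⟨1, zero_le_one, fun x hx k => by
      simp [abs_of_nonneg (skellamPMF_nonneg (hc.le.trans hx.1) k)]⟩
  | succ j ih =>
    obtain ⟨K, hK, ih⟩ := ih
    rcases le_or_gt c C with hcC | hcC
    · have hC : 0 < C := hc.trans_le hcC
      refine ⟨K * (2 ^ j * (2 * (C + c⁻¹)) + 1), by positivity, fun x hx k => ?_⟩
      rw [Function.iterate_succ_apply']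
      exact abs_walkGenerator_le hc hx hK (ih x hx) k
    · exact ⟨0, le_rfl, by simp [Set.Icc_eq_empty hcC.not_ge]⟩

theorem exists_abs_score_le {c : ℝ} (hc : 0 < c) (C : ℝ) :
    ∃ K, 0 ≤ K ∧ ∀ x ∈ Set.Icc c C, ∀ k, |score x k| ≤ K * absWeight k := by
  simpa only [pow_one] using! exists_abs_derivRatio_le hc C 1

theorem exists_abs_scoreDeriv_le {c : ℝ} (hc : 0 < c) (C : ℝ) :
    ∃ K, 0 ≤ K ∧ ∀ x ∈ Set.Icc c C, ∀ k, |scoreDeriv x k| ≤ K * absWeight k ^ 2 := by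
  obtain ⟨K₁, -, h₁⟩ := exists_abs_score_le hc C
  obtain ⟨K₂, hK₂, h₂⟩ := exists_abs_derivRatio_le hc C 2
  refine ⟨K₂ + K₁ ^ 2, by positivity, fun x hx k => ?_⟩
  calc |scoreDeriv x k| ≤ |derivRatio 2 x k| + |score x k| ^ 2 :=
        (abs_sub _ _).trans_eq (by rw [abs_pow])
    _ ≤ K₂ * absWeight k ^ 2 + (K₁ * absWeight k) ^ 2 := by
        gcongr
        exacts [h₂ x hx k, h₁ x hx k]
    _ = _ := by ring

theorem exists_abs_scoreDerivTwo_le {c : ℝ} (hc : 0 < c) (C : ℝ) :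
    ∃ K, 0 ≤ K ∧ ∀ x ∈ Set.Icc c C, ∀ k, |scoreDerivTwo x k| ≤ K * absWeight k ^ 3 := by
  obtain ⟨K₁, hK₁, h₁⟩ := exists_abs_score_le hc C
  obtain ⟨K₂, hK₂, h₂⟩ := exists_abs_derivRatio_le hc C 2
  obtain ⟨K₂', hK₂', h₂'⟩ := exists_abs_scoreDeriv_le hc C
  obtain ⟨K₃, hK₃, h₃⟩ := exists_abs_derivRatio_le hc C 3
  refine ⟨K₃ + K₁ * K₂ + 2 * K₁ * K₂', by positivity, fun x hx k => ?_⟩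
  have hw := (absWeight_pos k).le
  calc |scoreDerivTwo x k|
      ≤ |derivRatio 3 x k| + |score x k| * |derivRatio 2 x k|
          + 2 * |score x k| * |scoreDeriv x k| := by
        refine (abs_sub _ _).trans (add_le_add ((abs_sub _ _).trans_eq ?_) (le_of_eq ?_))
        · rw [abs_mul]
        · rw [abs_mul, abs_mul, abs_two]
    _ ≤ K₃ * absWeight k ^ 3 + K₁ * absWeight k * (K₂ * absWeight k ^ 2)
          + 2 * (K₁ * absWeight k) * (K₂' * absWeight k ^ 2) := by
        gcongr
        exacts [h₃ x hx k, h₁ x hx k, h₂ x hx k, h₁ x hx k, h₂' x hx k]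
    _ = _ := by ring

theorem exists_abs_log_skellamPMF_sub_taylor_le {c : ℝ} (hc : 0 < c) (C : ℝ) :
    ∃ K, ∀ x ∈ Set.Icc c C, ∀ y ∈ Set.Icc c C, ∀ k,
      |Real.log (skellamPMF y k) - Real.log (skellamPMF x k) - score x k * (y - x)
        - scoreDeriv x k * (y - x) ^ 2 / 2| ≤ K * absWeight k ^ 3 * |y - x| ^ 3 := by
  obtain ⟨K, -, hK⟩ := exists_abs_scoreDerivTwo_le hc C
  exact ⟨K, fun x hx y hy k => abs_sub_taylor_two_le (convex_Icc c C)
    (fun z hz => hasDerivAt_log_skellamPMF k (hc.trans_le hz.1))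
    (fun z hz => hasDerivAt_score k (hc.trans_le hz.1))
    (fun z hz => hasDerivAt_scoreDeriv k (hc.trans_le hz.1)) (fun z hz => hK z hz k) hx hy⟩

end Bounds

section FisherInformation

variable {x : ℝ}

theorem integrable_derivRatio (hx : 0 < x) (j : ℕ) :
    Integrable (derivRatio j x) (skellamMeasure x) := by
  obtain ⟨K, -, hK⟩ := exists_abs_derivRatio_le hx x j
  exact integrable_of_abs_le_absWeight_pow hx.le (hK x (Set.right_mem_Icc.2 le_rfl))

theorem integrable_abs_score_pow (hx : 0 < x) (j : ℕ) :
    Integrable (fun k => |score x k| ^ j) (skellamMeasure x) := by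
  obtain ⟨K, -, h⟩ := exists_abs_score_le hx x
  refine integrable_of_abs_le_absWeight_pow (K := K ^ j) (j := j) hx.le fun k => ?_
  rw [abs_pow, abs_abs, ← mul_pow]
  exact pow_le_pow_left₀ (abs_nonneg _) (h x (Set.right_mem_Icc.2 le_rfl) k) j

theorem integrable_score_sq (hx : 0 < x) :
    Integrable (fun k => score x k ^ 2) (skellamMeasure x) := by
  simpa only [sq_abs] using integrable_abs_score_pow hx 2

theorem memLp_scoreDeriv (hx : 0 < x) : MemLp (scoreDeriv x) 2 (skellamMeasure x) := by
  obtain ⟨K, -, h⟩ := exists_abs_scoreDeriv_le hx x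
  refine (memLp_two_iff_integrable_sq (measurable_of_countable _).aestronglyMeasurable).2
    (integrable_of_abs_le_absWeight_pow (K := K ^ 2) (j := 4) hx.le fun k => ?_)
  rw [abs_pow, show absWeight k ^ 4 = (absWeight k ^ 2) ^ 2 by ring, ← mul_pow]
  exact pow_le_pow_left₀ (abs_nonneg _) (h x (Set.right_mem_Icc.2 le_rfl) k) 2

theorem integral_derivRatio_succ (hx : 0 < x) (j : ℕ) :
    ∫ k, derivRatio (j + 1) x k ∂(skellamMeasure x) = 0 := by
  have hsum : ∀ i, Summable (walkGenerator^[i] (skellamPMF x)) := fun i => by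
    induction i with
    | zero => exact (hasSum_skellamPMF hx.le).summable
    | succ i ih =>
      rw [Function.iterate_succ_apply']
      exact (hasSum_walkGenerator ih).summable
  refine (hasSum_integral_skellamMeasure hx.le (integrable_derivRatio hx (j + 1))).unique
    ((hasSum_walkGenerator (hsum j)).congr_fun fun k => ?_)
  rw [derivRatio, mul_div_cancel₀ _ (skellamPMF_pos hx k).ne', Function.iterate_succ_apply']

theorem integral_score (hx : 0 < x) : ∫ k, score x k ∂(skellamMeasure x) = 0 :=
  integral_derivRatio_succ hx 0

theorem integral_scoreDeriv (hx : 0 < x) :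
    ∫ k, scoreDeriv x k ∂(skellamMeasure x) = -fisherInfo x := by
  simp only [scoreDeriv]
  rw [integral_sub (integrable_derivRatio hx 2) (integrable_score_sq hx),
    integral_derivRatio_succ hx 1, zero_sub, fisherInfo]

theorem fisherInfo_pos (hx : 0 < x) : 0 < fisherInfo x := by
  obtain ⟨n, hn⟩ := exists_nat_gt x
  have hscore : 0 < score x n := by
    have hratio : 0 < besselI (n + 1) x / besselI n x :=
      div_pos (besselI_pos _ hx) (besselI_pos _ hx)
    have hinv : 1 < x⁻¹ * n := by rwa [← div_eq_inv_mul, one_lt_div hx]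
    rw [score_eq_besselI_div _ hx, Int.natAbs_natCast, Int.cast_natCast, Nat.abs_cast]
    linarith
  refine (mul_pos (skellamPMF_pos hx n) (pow_pos hscore 2)).trans_le
    (le_hasSum (hasSum_integral_skellamMeasure hx.le (integrable_score_sq hx)) (n : ℤ)
      fun k _ => mul_nonneg (skellamPMF_nonneg hx.le k) (sq_nonneg _))

theorem continuousAt_fisherInfo (hx : 0 < x) : ContinuousAt fisherInfo x := by
  have hmem : Set.Icc (x / 2) (2 * x) ∈ 𝓝 x := Icc_mem_nhds (by linarith) (by linarith)
  obtain ⟨K, -, h⟩ := exists_abs_score_le (half_pos hx) (2 * x)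
  have hval : ∀ y, 0 < y → fisherInfo y = ∑' k, skellamPMF y k * score y k ^ 2 := fun y hy =>
    (hasSum_integral_skellamMeasure hy.le (integrable_score_sq hy)).tsum_eq.symm
  have hev : (fun y => ∑' k, skellamPMF y k * score y k ^ 2) =ᶠ[𝓝 x] fisherInfo :=
    (lt_mem_nhds hx).mono fun y hy => (hval y hy).symm
  refine Tendsto.congr' hev ?_
  rw [hval x hx]
  refine tendsto_tsum_of_dominated_convergence
    (((hasSum_skellamPMF (x := Real.exp 1 * (2 * x)) (by positivity)).summable.mul_left
      (2 ! * Real.exp 1 * Real.exp (Real.exp 1 * (2 * x)))).mul_left (K ^ 2))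
    (fun k => (hasDerivAt_skellamPMF k x).continuousAt.mul
      ((hasDerivAt_score k hx).continuousAt.pow 2)) ?_
  filter_upwards [hmem] with y hy k
  have hy0 : 0 ≤ y := (half_pos hx).le.trans hy.1
  have hp := skellamPMF_nonneg hy0 k
  calc ‖skellamPMF y k * score y k ^ 2‖ = skellamPMF y k * |score y k| ^ 2 := by
        rw [Real.norm_eq_abs, abs_mul, abs_pow, abs_of_nonneg hp]
    _ ≤ skellamPMF y k * (K * absWeight k) ^ 2 := by
        gcongr
        exact h y hy k
    _ = K ^ 2 * (skellamPMF y k * absWeight k ^ 2) := by ring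
    _ ≤ _ := mul_le_mul_of_nonneg_left (skellamPMF_mul_absWeight_pow_le 2 ⟨hy0, hy.2⟩ k)
        (sq_nonneg K)

end FisherInformation

section Independence

variable {Ω : Type*} [MeasurableSpace Ω] {P : Measure Ω}

theorem measure_prodMk_mem_of_indepFun {α β : Type*} [MeasurableSpace α] [MeasurableSpace β]
    [IsProbabilityMeasure P] {X : Ω → α} {Y : Ω → β} (hX : Measurable X) (hY : Measurable Y)
    (hXY : IndepFun X Y P) {s : Set (α × β)} (hs : MeasurableSet s) :
    P {ω | (X ω, Y ω) ∈ s} = ∫⁻ y, P {ω | (X ω, y) ∈ s} ∂P.map Y := by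
  have := Measure.isProbabilityMeasure_map (μ := P) hX.aemeasurable
  have := Measure.isProbabilityMeasure_map (μ := P) hY.aemeasurable
  calc P {ω | (X ω, Y ω) ∈ s}
      = P.map (fun ω => (X ω, Y ω)) s := (Measure.map_apply (hX.prodMk hY) hs).symm
    _ = ∫⁻ y, P.map X ((fun x => (x, y)) ⁻¹' s) ∂P.map Y := by
        rw [(indepFun_iff_map_prod_eq_prod_map_map hX.aemeasurable hY.aemeasurable).1 hXY,
          Measure.prod_apply_symm hs]
    _ = ∫⁻ y, P {ω | (X ω, y) ∈ s} ∂P.map Y :=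
        lintegral_congr fun y => Measure.map_apply hX (measurable_prodMk_right hs)

theorem lintegral_fintype_prod_eq_prod {ι : Type*} [Fintype ι] {α : ι → Type*}
    [∀ i, MeasurableSpace (α i)] (μ : ∀ i, Measure (α i)) [∀ i, IsProbabilityMeasure (μ i)]
    {f : ∀ i, α i → ℝ≥0∞} (hf : ∀ i, Measurable (f i)) :
    ∫⁻ x, ∏ i, f i (x i) ∂Measure.pi μ = ∏ i, ∫⁻ y, f i y ∂μ i := by
  rw [lintegral_prod_eq_prod_lintegral_of_indepFun Finset.univ (fun i (x : ∀ i, α i) => f i (x i))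
    (iIndepFun_pi fun i => (hf i).aemeasurable) fun i => (hf i).comp (measurable_pi_apply i)]
  exact Finset.prod_congr rfl fun i _ => (measurePreserving_eval μ i).lintegral_comp (hf i)

theorem measure_forall_sum_eq_prod_of_iIndepFun {α ι J : Type*} [AddCommMonoid α]
    [MeasurableSpace α] [MeasurableAdd₂ α] [MeasurableSingletonClass α] {ε : ι → Ω → α}
    (hε : ∀ i, Measurable (ε i)) (h : iIndepFun ε P) {S : J → Finset ι}
    (hS : Pairwise (Function.onFun Disjoint S)) (k : J → α) (A : Finset J) :
    P {ω | ∀ j ∈ A, ∑ i ∈ S j, ε i ω = k j} = ∏ j ∈ A, P {ω | ∑ i ∈ S j, ε i ω = k j} := by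
  classical
  have := h.isProbabilityMeasure
  let σ : ι → MeasurableSpace Ω := fun i => MeasurableSpace.comap (ε i) inferInstance
  let m : Set ι → MeasurableSpace Ω := fun B => ⨆ i ∈ B, σ i
  have measurableSet_sum_eq {B : Set ι} {j} (hj : ↑(S j) ⊆ B) :
      MeasurableSet[m B] {ω | ∑ i ∈ S j, ε i ω = k j} :=
    (Finset.measurable_fun_sum (m := m B) (S j) fun i hi =>
      (comap_measurable (ε i)).mono (le_biSup σ (hj hi)) le_rfl) (measurableSet_singleton (k j))
  induction A using Finset.induction with
  | empty => simp
  | insert j₀ A hj₀ ih =>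
    have hind : Indep (m (⋃ j ∈ A, S j)) (m (S j₀)) P :=
      indep_iSup_of_disjoint (fun i => (hε i).comap_le) h.iIndep <| by
        simp only [Set.disjoint_iUnion_left, Finset.disjoint_coe]
        exact fun j hj => hS fun e => hj₀ (e ▸ hj)
    have hA : MeasurableSet[m (⋃ j ∈ A, S j)] {ω | ∀ j ∈ A, ∑ i ∈ S j, ε i ω = k j} := by
      simp only [Set.ofPred_forall]
      exact Finset.measurableSet_biInter A fun j hj =>
        measurableSet_sum_eq (Set.subset_biUnion_of_mem (u := fun j => (S j : Set ι)) hj)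
    rw [Finset.prod_insert hj₀, ← ih, mul_comm,
      ← (Indep_iff _ _ _).1 hind _ _ hA (measurableSet_sum_eq subset_rfl)]
    congr 1
    ext ω
    simp [and_comm]

end Independence

namespace IsSymmetricSigns

variable {Ω : Type*} [MeasurableSpace Ω] {P : Measure Ω} {ε : ℕ → Ω → ℤ}

theorem isProbabilityMeasure (h : IsSymmetricSigns P ε) : IsProbabilityMeasure P :=
  h.indep.isProbabilityMeasure

theorem ae_eq_one_or_eq_neg_one (h : IsSymmetricSigns P ε) (i : ℕ) :
    ∀ᵐ ω ∂P, ε i ω = 1 ∨ ε i ω = -1 := by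
  have := h.isProbabilityMeasure
  have hmeas : ∀ k, MeasurableSet {ω | ε i ω = k} := fun k =>
    h.measurable i (measurableSet_singleton k)
  have hdisj : Disjoint {ω | ε i ω = 1} {ω | ε i ω = -1} :=
    Set.disjoint_left.2 fun ω (h₁ : ε i ω = 1) (h₂ : ε i ω = -1) => by omega
  refine (mem_ae_iff_prob_eq_one ((hmeas 1).union (hmeas (-1)))).2 ?_
  rw [measure_union hdisj (hmeas _), h.prob_one, h.prob_neg_one, ENNReal.add_halves]

theorem measure_add_eq (h : IsSymmetricSigns P ε) {i : ℕ} {Y : Ω → ℤ} (hY : Measurable Y)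
    (hYi : IndepFun Y (ε i) P) (k : ℤ) :
    P {ω | Y ω + ε i ω = k} = (P {ω | Y ω = k - 1} + P {ω | Y ω = k + 1}) / 2 := by
  have hae : {ω | Y ω + ε i ω = k} =ᵐ[P]
      ((Y ⁻¹' {k - 1} ∩ ε i ⁻¹' {1}) ∪ (Y ⁻¹' {k + 1} ∩ ε i ⁻¹' {-1}) : Set Ω) := by
    filter_upwards [h.ae_eq_one_or_eq_neg_one i] with ω hω
    apply propext
    change Y ω + ε i ω = k ↔ (Y ω = k - 1 ∧ ε i ω = 1) ∨ (Y ω = k + 1 ∧ ε i ω = -1)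
    omega
  have hdisj : Disjoint (Y ⁻¹' {k - 1} ∩ ε i ⁻¹' {1}) (Y ⁻¹' {k + 1} ∩ ε i ⁻¹' {-1}) :=
    Set.disjoint_left.2 fun ω ⟨(h₁ : Y ω = k - 1), _⟩ ⟨(h₂ : Y ω = k + 1), _⟩ => by omega
  rw [measure_congr hae, measure_union hdisj ((hY (measurableSet_singleton _)).inter
      (h.measurable i (measurableSet_singleton _))),
    hYi.measure_inter_preimage_eq_mul _ _ (measurableSet_singleton _) (measurableSet_singleton _),
    hYi.measure_inter_preimage_eq_mul _ _ (measurableSet_singleton _) (measurableSet_singleton _),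
    show P (ε i ⁻¹' {1}) = 1 / 2 from h.prob_one i,
    show P (ε i ⁻¹' {-1}) = 1 / 2 from h.prob_neg_one i, ← add_mul, mul_one_div]
  rfl

theorem measure_sum_eq (h : IsSymmetricSigns P ε) (s : Finset ℕ) (k : ℤ) :
    P {ω | ∑ i ∈ s, ε i ω = k} = ENNReal.ofReal (walkProb s.card k) := by
  have := h.isProbabilityMeasure
  induction s using Finset.induction generalizing k with
  | empty => by_cases hk : k = 0 <;> simp [hk, walkProb, eq_comm (a := (0 : ℤ))]
  | insert i s hi ih =>
    have hind : IndepFun (fun ω => ∑ i ∈ s, ε i ω) (ε i) P := by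
      simpa only [Finset.sum_fn] using h.indep.indepFun_finsetSum_of_notMem h.measurable hi
    simp_rw [Finset.sum_insert hi, add_comm (ε i _), Finset.card_insert_of_notMem hi, walkProb,
      neighborMean]
    rw [h.measure_add_eq (Finset.measurable_fun_sum s fun i _ => h.measurable i) hind, ih, ih,
      ENNReal.ofReal_div_of_pos two_pos,
      ENNReal.ofReal_add (walkProb_nonneg _ _) (walkProb_nonneg _ _), ENNReal.ofReal_ofNat]

theorem map_sum_eq_pi_skellamMeasure (h : IsSymmetricSigns P ε) {J : Type*} [Fintype J]
    {S : (J → ℕ) → J → Finset ℕ} (hS : ∀ m, Pairwise (Function.onFun Disjoint (S m)))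
    (hcard : ∀ m j, (S m j).card = m j) {M : Ω → J → ℕ} (hM : Measurable M) {r : ℝ≥0}
    (hlaw : P.map M = Measure.pi fun _ => poissonMeasure r)
    (hind : IndepFun (fun ω i => ε i ω) M P) :
    P.map (fun ω j => ∑ i ∈ S (M ω) j, ε i ω) = Measure.pi fun _ => skellamMeasure r := by
  have := h.isProbabilityMeasure
  have hε : Measurable fun ω i => ε i ω := measurable_pi_lambda _ h.measurable
  let W : (ℕ → ℤ) × (J → ℕ) → J → ℤ := fun p j => ∑ i ∈ S p.2 j, p.1 i
  have hW : Measurable W := measurable_from_prod_countable_left fun m =>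
    measurable_pi_lambda _ fun j =>
      Finset.measurable_fun_sum (S m j) fun i _ => measurable_pi_apply i
  refine Measure.ext_of_singleton fun k => ?_
  calc P.map (fun ω j => ∑ i ∈ S (M ω) j, ε i ω) {k}
      = P {ω | (fun i => ε i ω, M ω) ∈ W ⁻¹' {k}} :=
        Measure.map_apply (hW.comp (hε.prodMk hM)) (measurableSet_singleton k)
    _ = ∫⁻ m, P {ω | ∀ j ∈ Finset.univ, ∑ i ∈ S m j, ε i ω = k j} ∂P.map M := by
        rw [measure_prodMk_mem_of_indepFun hε hM hind (hW (measurableSet_singleton k))]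
        simp [W, funext_iff]
    _ = ∫⁻ m, ∏ j, ENNReal.ofReal (walkProb (m j) (k j)) ∂Measure.pi fun _ => poissonMeasure r := by
        simp_rw [measure_forall_sum_eq_prod_of_iIndepFun h.measurable h.indep (hS _),
          h.measure_sum_eq, hcard, hlaw]
    _ = ∏ j, ∫⁻ d, ENNReal.ofReal (walkProb d (k j)) ∂poissonMeasure r :=
        lintegral_fintype_prod_eq_prod (f := fun j d => ENNReal.ofReal (walkProb d (k j))) _
          fun j => measurable_of_countable _
    _ = (Measure.pi fun _ => skellamMeasure r) {k} := by
        simp_rw [lintegral_walkProb_poissonMeasure, Measure.pi_singleton,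
          skellamMeasure_singleton r.coe_nonneg]

end IsSymmetricSigns

section Blocks

variable {n : ℕ}

/-- The `j`-th of the consecutive blocks of lengths `m 0, m 1, …` into which `ℕ` is cut. -/
def consecutiveBlock (m : Fin n → ℕ) (j : Fin n) : Finset ℕ :=
  Finset.Ico (∑ l ∈ Finset.Iio j, m l) (∑ l ∈ Finset.Iic j, m l)

theorem card_consecutiveBlock (m : Fin n → ℕ) (j : Fin n) : (consecutiveBlock m j).card = m j := by
  rw [consecutiveBlock, Nat.card_Ico, ← Finset.sum_Iio_add_eq_sum_Iic, Nat.add_sub_cancel_left]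

theorem pairwise_disjoint_consecutiveBlock (m : Fin n → ℕ) :
    Pairwise (Function.onFun Disjoint (consecutiveBlock m)) := by
  refine (pairwise_disjoint_on _).2 fun i j hij => ?_
  have hle : ∑ l ∈ Finset.Iic i, m l ≤ ∑ l ∈ Finset.Iio j, m l :=
    Finset.sum_le_sum_of_subset fun l hl => by
      simp only [Finset.mem_Iic, Finset.mem_Iio] at hl ⊢
      exact hl.trans_lt hij
  rw [Finset.disjoint_left]
  simp only [consecutiveBlock, Finset.mem_Ico]
  omega

theorem consecutiveBlock_sub {c : ℕ → ℕ} (hc : Monotone c) (h0 : c 0 = 0) (j : Fin n) :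
    consecutiveBlock (fun l : Fin n => c (l + 1) - c l) j = Finset.Ico (c j) (c (j + 1)) := by
  have hIio : ∑ l ∈ Finset.Iio j, (c (l + 1) - c l) = c j := by
    have hrange := Finset.sum_range_tsub hc (j : ℕ)
    rw [h0, Nat.sub_zero, Finset.range_eq_Ico, ← bot_eq_zero, Finset.Ico_bot,
      ← Fin.map_valEmbedding_Iio, Finset.sum_map] at hrange
    exact hrange
  rw [consecutiveBlock, ← Finset.sum_Iio_add_eq_sum_Iic, hIio,
    Nat.add_sub_of_le (hc (Nat.le_succ j))]

/-- The successive differences of a finite sequence, starting from `0`: the passage from the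
observations of a process on a grid to its increments. -/
def differences (y : Fin n → ℤ) (i : Fin n) : ℤ :=
  y i - (Fin.cons 0 y : Fin (n + 1) → ℤ) i.castSucc

theorem differences_injective (n : ℕ) : Function.Injective (differences (n := n)) := by
  intro y z h
  have hcons : ∀ j, (Fin.cons 0 y : Fin (n + 1) → ℤ) j = (Fin.cons 0 z : Fin (n + 1) → ℤ) j :=
    Fin.induction rfl fun i hi => by
      have hdiff := congrFun h i
      rwa [differences, differences, hi, sub_left_inj] at hdiff
  exact funext fun i => hcons i.succ

theorem differences_apply_succ (x : ℕ → ℤ) (i : Fin n) (h0 : x 0 = 0) :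
    differences (fun j : Fin n => x (j + 1)) i = x (i + 1) - x i := by
  have hcons : (Fin.cons 0 fun j : Fin n => x (j + 1)) = fun j : Fin (n + 1) => x j := by
    ext j
    cases j using Fin.cases <;> simp [h0]
  rw [differences, hcons]
  rfl

end Blocks

/-- The `j`-th observation time `j Δ`. -/
noncomputable def gridTime (Δ : ℝ) (j : ℕ) : ℝ≥0 := (j * Δ).toNNReal

theorem gridTime_zero (Δ : ℝ) : gridTime Δ 0 = 0 := by
  simp [gridTime]

theorem gridTime_mono {Δ : ℝ} (hΔ : 0 ≤ Δ) : Monotone (gridTime Δ) := fun i j hij => by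
  unfold gridTime
  gcongr

theorem gridTime_succ_sub {Δ : ℝ} (hΔ : 0 ≤ Δ) (j : ℕ) :
    gridTime Δ (j + 1) - gridTime Δ j = Δ.toNNReal := by
  unfold gridTime
  rw [Nat.cast_succ, add_one_mul, Real.toNNReal_add (by positivity) hΔ, add_tsub_cancel_left]

section CompoundPoisson

variable {Ω : Type*} [MeasurableSpace Ω] {P : Measure Ω} {ϑ : ℝ}

theorem IsPoissonProcess.map_increments {N : ℝ≥0 → Ω → ℕ} (hN : IsPoissonProcess P ϑ N) {Δ : ℝ}
    (hΔ : 0 ≤ Δ) (n : ℕ) :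
    P.map (fun ω (i : Fin n) => N (gridTime Δ (i + 1)) ω - N (gridTime Δ i) ω)
      = Measure.pi fun _ => poissonMeasure (ϑ.toNNReal * Δ.toNNReal) := by
  have hind : iIndepFun
      (fun (i : Fin n) ω => N (gridTime Δ (i + 1)) ω - N (gridTime Δ i) ω) P :=
    hN.indep_increments n (fun i => gridTime Δ i)
      ((gridTime_mono hΔ).comp Fin.val_strictMono.monotone)
  refine (hind.map_fun_eq_pi_map fun i =>
    ((hN.measurable _).sub (hN.measurable _)).aemeasurable).trans ?_
  congr 1 with i : 1
  exact (hN.law_increments _ _ (gridTime_mono hΔ (Nat.le_succ i))).map_eq.trans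
    (by rw [gridTime_succ_sub hΔ])

namespace IsSymmetricCompoundPoisson

variable {X : ℝ≥0 → Ω → ℤ}

theorem isProbabilityMeasure (hX : IsSymmetricCompoundPoisson P ϑ X) :
    IsProbabilityMeasure P := by
  obtain ⟨N, ε, -, hε, -⟩ := hX
  exact hε.isProbabilityMeasure

theorem measurable (hX : IsSymmetricCompoundPoisson P ϑ X) (t : ℝ≥0) : Measurable (X t) := by
  obtain ⟨N, ε, hN, hε, -, hsum⟩ := hX
  have hwalk : Measurable fun p : ℕ × Ω => ∑ i ∈ Finset.range p.1, ε i p.2 :=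
    measurable_from_prod_countable_right fun m =>
      Finset.measurable_fun_sum (Finset.range m) fun i _ => hε.measurable i
  rw [funext (hsum t)]
  exact hwalk.comp ((hN.measurable t).prodMk measurable_id)

theorem ae_zero (hX : IsSymmetricCompoundPoisson P ϑ X) : ∀ᵐ ω ∂P, X 0 ω = 0 := by
  obtain ⟨N, ε, hN, -, -, hsum⟩ := hX
  filter_upwards [hN.zero] with ω hω
  rw [hsum, hω, Finset.sum_range_zero]

theorem map_increments (hX : IsSymmetricCompoundPoisson P ϑ X) (hϑ : 0 ≤ ϑ) {Δ : ℝ} (hΔ : 0 ≤ Δ)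
    (n : ℕ) :
    P.map (fun ω (i : Fin n) => X (gridTime Δ (i + 1)) ω - X (gridTime Δ i) ω)
      = Measure.pi fun _ => skellamMeasure (ϑ * Δ) := by
  obtain ⟨N, ε, hN, hε, hind, hsum⟩ := hX
  let increments : (ℝ≥0 → ℕ) → Fin n → ℕ := fun f i => f (gridTime Δ (i + 1)) - f (gridTime Δ i)
  have hincrements : Measurable increments :=
    measurable_pi_lambda _ fun i => (measurable_pi_apply _).sub (measurable_pi_apply _)
  let M : Ω → Fin n → ℕ := fun ω => increments fun t => N t ω
  have hM : Measurable M := hincrements.comp (measurable_pi_lambda _ hN.measurable)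
  have hXM : ∀ᵐ ω ∂P, (fun i : Fin n => X (gridTime Δ (i + 1)) ω - X (gridTime Δ i) ω)
      = fun i => ∑ l ∈ consecutiveBlock (M ω) i, ε l ω := by
    filter_upwards [hN.zero, hN.mono] with ω h0 hmono
    have hc : Monotone fun j => N (gridTime Δ j) ω := hmono.comp (gridTime_mono hΔ)
    ext i
    rw [hsum, hsum, ← Finset.sum_Ico_eq_sub _ (hc (Nat.le_succ i)),
      ← consecutiveBlock_sub hc (by rw [gridTime_zero, h0])]
  rw [Measure.map_congr hXM, hε.map_sum_eq_pi_skellamMeasure pairwise_disjoint_consecutiveBlock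
      card_consecutiveBlock hM (hN.map_increments hΔ n) (hind.comp measurable_id hincrements),
    NNReal.coe_mul, Real.coe_toNNReal _ hϑ, Real.coe_toNNReal _ hΔ]

theorem map_eval (hX : IsSymmetricCompoundPoisson P ϑ X) (hϑ : 0 ≤ ϑ) {Δ : ℝ} (hΔ : 0 ≤ Δ) :
    P.map (X Δ.toNNReal) = skellamMeasure (ϑ * Δ) := by
  have hmeas : Measurable fun ω (i : Fin 1) => X (gridTime Δ (i + 1)) ω - X (gridTime Δ i) ω :=
    measurable_pi_lambda _ fun i => (hX.measurable _).sub (hX.measurable _)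
  have hincr : P.map (fun ω => X (gridTime Δ 1) ω - X (gridTime Δ 0) ω)
      = skellamMeasure (ϑ * Δ) := by
    rw [← (measurePreserving_eval (fun _ : Fin 1 => skellamMeasure (ϑ * Δ)) 0).map_eq,
      ← hX.map_increments hϑ hΔ 1, Measure.map_map (measurable_pi_apply _) hmeas]
    rfl
  rw [← hincr]
  refine Measure.map_congr ?_
  filter_upwards [hX.ae_zero] with ω h0
  simp [gridTime, h0]

theorem scaleInformation_eq (hX : IsSymmetricCompoundPoisson P ϑ X) (hϑ : 0 < ϑ) (T : ℝ) {Δ : ℝ}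
    (hΔ : 0 < Δ) : scaleInformation P X T Δ ϑ = T * Δ * fisherInfo (ϑ * Δ) := by
  rw [scaleInformation, fisherInfo, ← hX.map_eval hϑ.le hΔ.le,
    integral_map (hX.measurable _).aemeasurable (measurable_of_countable _).aestronglyMeasurable]
  simp_rw [score_eq_besselI_div _ (mul_pos hϑ hΔ), besselRatio]

theorem scaleInformation_pos (hX : IsSymmetricCompoundPoisson P ϑ X) (hϑ : 0 < ϑ) {T Δ : ℝ}
    (hT : 0 < T) (hΔ : 0 < Δ) : 0 < scaleInformation P X T Δ ϑ := by
  rw [hX.scaleInformation_eq hϑ T hΔ]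
  exact mul_pos (mul_pos hT hΔ) (fisherInfo_pos (mul_pos hϑ hΔ))

theorem map_differences_observationLaw (hX : IsSymmetricCompoundPoisson P ϑ X) (hϑ : 0 ≤ ϑ)
    (T : ℝ) {Δ : ℝ} (hΔ : 0 ≤ Δ) :
    (observationLaw P X T Δ).map differences = Measure.pi fun _ => skellamMeasure (ϑ * Δ) := by
  rw [observationLaw, Measure.map_map (measurable_of_countable _)
    (measurable_pi_lambda _ fun i => hX.measurable _), ← hX.map_increments hϑ hΔ]
  refine Measure.map_congr ?_
  filter_upwards [hX.ae_zero] with ω h0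
  ext i
  rw [← differences_apply_succ (fun j => X (gridTime Δ j) ω) i (by rw [gridTime_zero, h0])]
  simp [gridTime]

theorem isProbabilityMeasure_observationLaw (hX : IsSymmetricCompoundPoisson P ϑ X) (T Δ : ℝ) :
    IsProbabilityMeasure (observationLaw P X T Δ) :=
  have := hX.isProbabilityMeasure
  Measure.isProbabilityMeasure_map (measurable_pi_lambda _ fun _ => hX.measurable _).aemeasurable

theorem observationLaw_singleton (hX : IsSymmetricCompoundPoisson P ϑ X) (hϑ : 0 ≤ ϑ) (T : ℝ)
    {Δ : ℝ} (hΔ : 0 ≤ Δ) (y : Fin ⌊T / Δ⌋₊ → ℤ) :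
    observationLaw P X T Δ {y}
      = ENNReal.ofReal (∏ i, skellamPMF (ϑ * Δ) (differences y i)) := by
  have hx : 0 ≤ ϑ * Δ := mul_nonneg hϑ hΔ
  calc observationLaw P X T Δ {y}
      = (observationLaw P X T Δ).map differences {differences y} := by
        rw [Measure.map_apply (measurable_of_countable _) (measurableSet_singleton _),
          ← Set.image_singleton, (differences_injective _).preimage_image]
    _ = ∏ i, ENNReal.ofReal (skellamPMF (ϑ * Δ) (differences y i)) := by
        simp_rw [hX.map_differences_observationLaw hϑ T hΔ, Measure.pi_singleton,
          skellamMeasure_singleton hx]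
    _ = _ := (ENNReal.ofReal_prod_of_nonneg fun i _ => skellamPMF_nonneg hx _).symm

theorem toReal_rnDeriv_observationLaw (hX : IsSymmetricCompoundPoisson P ϑ X) (hϑ : 0 < ϑ)
    {P' : Measure Ω} {ϑ' : ℝ} {X' : ℝ≥0 → Ω → ℤ} (hX' : IsSymmetricCompoundPoisson P' ϑ' X')
    (hϑ' : 0 < ϑ') (T : ℝ) {Δ : ℝ} (hΔ : 0 < Δ) :
    ∀ᵐ y ∂observationLaw P X T Δ,
      ((observationLaw P' X' T Δ).rnDeriv (observationLaw P X T Δ) y).toReal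
        = Real.exp (∑ i, (Real.log (skellamPMF (ϑ' * Δ) (differences y i))
            - Real.log (skellamPMF (ϑ * Δ) (differences y i)))) := by
  have := hX.isProbabilityMeasure_observationLaw T Δ
  have hprod {ϑ : ℝ} (hϑ : 0 < ϑ) (y : Fin ⌊T / Δ⌋₊ → ℤ) :
      0 < ∏ i, skellamPMF (ϑ * Δ) (differences y i) :=
    Finset.prod_pos fun i _ => skellamPMF_pos (mul_pos hϑ hΔ) _
  have hpos : ∀ y, observationLaw P X T Δ {y} ≠ 0 := fun y => by
    rw [hX.observationLaw_singleton hϑ.le T hΔ.le]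
    exact (ENNReal.ofReal_pos.2 (hprod hϑ y)).ne'
  filter_upwards [rnDeriv_ae_eq_div_singleton _ (observationLaw P' X' T Δ) hpos] with y hy
  rw [hy, hX.observationLaw_singleton hϑ.le T hΔ.le, hX'.observationLaw_singleton hϑ'.le T hΔ.le,
    ENNReal.toReal_div, ENNReal.toReal_ofReal (hprod hϑ y).le,
    ENNReal.toReal_ofReal (hprod hϑ' y).le, Real.exp_sum, ← Finset.prod_div_distrib]
  refine Finset.prod_congr rfl fun i _ => ?_
  rw [Real.exp_sub, Real.exp_log (skellamPMF_pos (mul_pos hϑ' hΔ) _),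
    Real.exp_log (skellamPMF_pos (mul_pos hϑ hΔ) _)]

end IsSymmetricCompoundPoisson

end CompoundPoisson

/-- The error of the quadratic approximation `δ * ∑ j, score x (d j) - a / 2` to the
log-likelihood ratio of the parameters `x + δ` and `x`, for a Skellam sample `d`. -/
noncomputable def lanRemainder (x δ a : ℝ) {m : ℕ} (d : Fin m → ℤ) : ℝ :=
  ∑ j, (Real.log (skellamPMF (x + δ) (d j)) - Real.log (skellamPMF x (d j)))
    - δ * ∑ j, score x (d j) + a / 2

section MomentBounds

variable {c : ℝ}

theorem memLp_score_three {x : ℝ} (hx : 0 < x) : MemLp (score x) 3 (skellamMeasure x) := by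
  rw [← integrable_norm_rpow_iff (measurable_of_countable _).aestronglyMeasurable (by norm_num)
    (by norm_num)]
  simpa using integrable_abs_score_pow hx 3

theorem exists_integral_abs_score_pow_three_le (hc : 0 < c) (C : ℝ) :
    ∃ M, ∀ x ∈ Set.Icc c C, ∫ k, |score x k| ^ 3 ∂(skellamMeasure x) ≤ M := by
  obtain ⟨K, -, hK⟩ := exists_abs_score_le hc C
  simp only [← abs_pow]
  refine exists_integral_abs_le_of_abs_le_absWeight_pow (K := K ^ 3) (j := 3)
    (Set.Icc_subset_Icc_left hc.le) fun x hx k => ?_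
  rw [abs_pow, ← mul_pow]
  exact pow_le_pow_left₀ (abs_nonneg _) (hK x hx k) 3

theorem exists_integral_scoreDeriv_sq_le (hc : 0 < c) (C : ℝ) :
    ∃ M, ∀ x ∈ Set.Icc c C, ∫ k, scoreDeriv x k ^ 2 ∂(skellamMeasure x) ≤ M := by
  obtain ⟨K, -, hK⟩ := exists_abs_scoreDeriv_le hc C
  have hsq : ∀ x ∈ Set.Icc c C, ∀ k, |scoreDeriv x k ^ 2| ≤ K ^ 2 * absWeight k ^ 4 :=
    fun x hx k => by
      rw [abs_pow, show K ^ 2 * absWeight k ^ 4 = (K * absWeight k ^ 2) ^ 2 by ring]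
      exact pow_le_pow_left₀ (abs_nonneg _) (hK x hx k) 2
  simpa only [abs_pow, sq_abs] using
    exists_integral_abs_le_of_abs_le_absWeight_pow (Set.Icc_subset_Icc_left hc.le) hsq

theorem exists_lintegral_enorm_lanRemainder_le (hc : 0 < c) (C : ℝ) :
    ∃ M, ∀ x ∈ Set.Icc c C, ∀ δ, x + δ ∈ Set.Icc c C → ∀ (n : ℕ) (a : ℝ),
      ∫⁻ d : Fin n → ℤ, ‖lanRemainder x δ a d‖ₑ ∂(Measure.pi fun _ => skellamMeasure x)
        ≤ ENNReal.ofReal (M * (n * |δ| ^ 3 + √n * δ ^ 2)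
          + |a - n * δ ^ 2 * fisherInfo x| / 2) := by
  obtain ⟨K, hK⟩ := exists_abs_log_skellamPMF_sub_taylor_le hc C
  obtain ⟨M, hM⟩ := exists_integral_scoreDeriv_sq_le hc C
  set B := 3 ! * Real.exp 1 * Real.exp (Real.exp 1 * C)
  refine ⟨max (|K| * B) (√M / 2), fun x hx δ hδ n a => ?_⟩
  have hx0 : 0 < x := hc.trans_le hx.1
  have hρint : ∫ k, |K| * |δ| ^ 3 * absWeight k ^ 3 ∂(skellamMeasure x)
      ≤ |K| * B * |δ| ^ 3 := by
    rw [integral_const_mul, mul_right_comm]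
    gcongr
    exact integral_absWeight_pow_le 3 ⟨hx0.le, hx.2⟩
  have hexpand : ∀ k, |Real.log (skellamPMF (x + δ) k) - Real.log (skellamPMF x k)
      - score x k * δ - scoreDeriv x k * δ ^ 2 / 2| ≤ |K| * |δ| ^ 3 * absWeight k ^ 3 :=
    fun k => by
      have hk := hK x hx (x + δ) hδ k
      rw [add_sub_cancel_left] at hk
      refine hk.trans ?_
      rw [mul_right_comm]
      have := absWeight_pos k
      gcongr
      exact le_abs_self K
  refine (lintegral_enorm_sum_quadratic_expansion_le (memLp_scoreDeriv hx0)
    ((integrable_absWeight_pow hx0.le 3).const_mul _) hexpand n a).trans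
    (ENNReal.ofReal_le_ofReal ?_)
  rw [integral_scoreDeriv hx0, mul_neg, ← sub_eq_add_neg]
  gcongr
  calc _ ≤ n * (|K| * B * |δ| ^ 3) + δ ^ 2 / 2 * √(n * M) := by
        gcongr
        exact hM x hx
    _ = |K| * B * (n * |δ| ^ 3) + √M / 2 * (√n * δ ^ 2) := by
        rw [Real.sqrt_mul n.cast_nonneg]
        ring
    _ ≤ _ := by
        rw [mul_add]
        gcongr
        exacts [le_max_left _ _, le_max_right _ _]

end MomentBounds

section LocalAlternatives

variable {ι : Type*} {l : Filter ι} {n : ι → ℕ} {x h : ι → ℝ} {c x₀ : ℝ}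

theorem tendsto_zero_of_tendsto_natCast_mul_sq (hn : Tendsto n l atTop)
    (hnh : Tendsto (fun i => n i * h i ^ 2) l (𝓝 c)) : Tendsto h l (𝓝 0) := by
  have hsq : Tendsto (fun i => h i ^ 2) l (𝓝 0) := by
    refine (hnh.div_atTop (tendsto_natCast_atTop_atTop.comp hn)).congr' ?_
    filter_upwards [hn.eventually_gt_atTop 0] with i hi
    exact mul_div_cancel_left₀ _ (Nat.cast_ne_zero.2 hi.ne')
  rw [tendsto_zero_iff_abs_tendsto_zero]
  simpa [Function.comp_def, Real.sqrt_sq_eq_abs] using (Real.continuous_sqrt.tendsto 0).comp hsq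

theorem tendsto_natCast_mul_abs_pow_three (hn : Tendsto n l atTop)
    (hnh : Tendsto (fun i => n i * h i ^ 2) l (𝓝 c)) :
    Tendsto (fun i => n i * |h i| ^ 3) l (𝓝 0) := by
  have hmul := hnh.mul (tendsto_zero_of_tendsto_natCast_mul_sq hn hnh).abs
  rw [abs_zero, mul_zero] at hmul
  refine hmul.congr fun i => ?_
  rw [← sq_abs]
  ring

theorem tendsto_sqrt_natCast_mul_sq (hn : Tendsto n l atTop)
    (hnh : Tendsto (fun i => n i * h i ^ 2) l (𝓝 c)) :
    Tendsto (fun i => √(n i) * h i ^ 2) l (𝓝 0) := by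
  have hmul := hnh.sqrt.mul (tendsto_zero_of_tendsto_natCast_mul_sq hn hnh).abs
  rw [abs_zero, mul_zero] at hmul
  refine hmul.congr fun i => ?_
  rw [Real.sqrt_mul (Nat.cast_nonneg _), Real.sqrt_sq_eq_abs, ← sq_abs (h i)]
  ring

theorem tendstoInDistribution_sum_score [l.IsCountablyGenerated] (hx₀ : 0 < x₀)
    (hx : Tendsto x l (𝓝 x₀)) (hn : Tendsto n l atTop)
    (hnh : Tendsto (fun i => n i * h i ^ 2) l (𝓝 (fisherInfo x₀)⁻¹)) :
    TendstoInDistribution (fun i (d : Fin (n i) → ℤ) => ∑ j, h i * score (x i) (d j)) l id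
      (fun i => Measure.pi fun _ => skellamMeasure (x i)) (gaussianReal 0 1) := by
  have hpos : ∀ᶠ i in l, 0 < x i := hx.eventually_const_lt hx₀
  obtain ⟨M, hM⟩ := exists_integral_abs_score_pow_three_le (half_pos hx₀) (2 * x₀)
  have hbounded : IsBoundedUnder (· ≤ ·) l
      (norm ∘ fun i => ∫ k, |score (x i) k| ^ 3 ∂(skellamMeasure (x i))) := by
    refine isBoundedUnder_of_eventually_le (a := M) ?_
    filter_upwards [hx.eventually (Icc_mem_nhds (half_lt_self hx₀) (by linarith : x₀ < 2 * x₀))]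
      with i hi
    rw [Function.comp_apply, Real.norm_of_nonneg (by positivity)]
    exact hM (x i) hi
  have hinfo := (continuousAt_fisherInfo hx₀).tendsto.comp hx
  refine tendstoInDistribution_sum_pi_gaussianReal
    (μ := fun i => skellamMeasure (x i)) (f := fun i k => h i * score (x i) k)
    (fun i => (measurable_of_countable _).aemeasurable) hn ?_ ?_ ?_ ?_
  · filter_upwards [hpos] with i hi using (memLp_score_three hi).const_mul (h i)
  · filter_upwards [hpos] with i hi
    rw [integral_const_mul, integral_score hi, mul_zero]
  · have hprod := hnh.mul hinfo
    rw [inv_mul_cancel₀ (fisherInfo_pos hx₀).ne'] at hprod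
    refine hprod.congr fun i => ?_
    simp only [mul_pow, integral_const_mul, mul_assoc, Function.comp_apply, fisherInfo]
  · refine ((tendsto_natCast_mul_abs_pow_three hn hnh).zero_mul_isBoundedUnder_le
      hbounded).congr fun i => ?_
    simp only [abs_mul, mul_pow, integral_const_mul, mul_assoc]

theorem tendsto_lintegral_enorm_lanRemainder (hx₀ : 0 < x₀) (hx : Tendsto x l (𝓝 x₀))
    (hn : Tendsto n l atTop) (hnh : Tendsto (fun i => n i * h i ^ 2) l (𝓝 (fisherInfo x₀)⁻¹))
    (v : ℝ) :
    Tendsto (fun i => ∫⁻ d : Fin (n i) → ℤ, ‖lanRemainder (x i) (v * h i) (v ^ 2) d‖ₑ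
      ∂(Measure.pi fun _ => skellamMeasure (x i))) l (𝓝 0) := by
  have hnvh : Tendsto (fun i => n i * (v * h i) ^ 2) l (𝓝 (v ^ 2 * (fisherInfo x₀)⁻¹)) :=
    (hnh.const_mul (v ^ 2)).congr fun i => by ring
  have hx' : Tendsto (fun i => x i + v * h i) l (𝓝 x₀) := by
    simpa only [add_zero] using hx.add (tendsto_zero_of_tendsto_natCast_mul_sq hn hnvh)
  have hinfo : Tendsto (fun i => |v ^ 2 - n i * (v * h i) ^ 2 * fisherInfo (x i)| / 2) l
      (𝓝 0) := by
    have hprod := hnvh.mul ((continuousAt_fisherInfo hx₀).tendsto.comp hx)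
    rw [inv_mul_cancel_right₀ (fisherInfo_pos hx₀).ne'] at hprod
    have habs := ((hprod.const_sub (v ^ 2)).abs).div_const 2
    rwa [sub_self, abs_zero, zero_div] at habs
  obtain ⟨M, hM⟩ := exists_lintegral_enorm_lanRemainder_le (half_pos hx₀) (2 * x₀)
  have hbound := ENNReal.tendsto_ofReal ((((tendsto_natCast_mul_abs_pow_three hn hnvh).add
    (tendsto_sqrt_natCast_mul_sq hn hnvh)).const_mul M).add hinfo)
  simp only [add_zero, mul_zero, ENNReal.ofReal_zero] at hbound
  have hnhds : Set.Icc (x₀ / 2) (2 * x₀) ∈ 𝓝 x₀ := Icc_mem_nhds (by linarith) (by linarith)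
  refine tendsto_of_tendsto_of_tendsto_of_le_of_le' tendsto_const_nhds hbound
    (Eventually.of_forall fun i => zero_le) ?_
  filter_upwards [hx.eventually hnhds, hx'.eventually hnhds] with i hi hi'
  exact hM _ hi _ hi' _ _

end LocalAlternatives

section LAN

variable {Δ J : ℝ → ℝ} {Δ_inf : ℝ}

theorem tendsto_id_div_atTop (hΔ_inf : 0 < Δ_inf) (hΔ : Tendsto Δ atTop (𝓝 Δ_inf)) :
    Tendsto (fun T => T / Δ T) atTop atTop :=
  tendsto_id.atTop_mul_pos (inv_pos.2 hΔ_inf) (hΔ.inv₀ hΔ_inf.ne')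

theorem tendsto_natFloor_div_mul_sq_div_sqrt {F : ℝ} (hF : 0 < F) (hΔ_inf : 0 < Δ_inf)
    (hΔ : Tendsto Δ atTop (𝓝 Δ_inf)) (hJ : J ~[atTop] fun T => T * Δ_inf * F) :
    Tendsto (fun T => ⌊T / Δ T⌋₊ * (Δ T / √(J T)) ^ 2) atTop (𝓝 F⁻¹) := by
  have hI : Tendsto (fun T => T * Δ_inf * F) atTop atTop :=
    (tendsto_id.atTop_mul_const hΔ_inf).atTop_mul_const hF
  have hratio : Tendsto (fun T => T * Δ_inf * F / J T) atTop (𝓝 1) :=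
    (isEquivalent_iff_tendsto_one
      ((hJ.symm.tendsto_atTop hI).eventually_ne_atTop 0)).1 hJ.symm
  have hprod := ((tendsto_nat_floor_div_atTop.comp (tendsto_id_div_atTop hΔ_inf hΔ)).mul
    (hΔ.mul hratio)).mul_const (Δ_inf * F)⁻¹
  have hlim : 1 * (Δ_inf * 1) * (Δ_inf * F)⁻¹ = F⁻¹ := by field_simp
  rw [hlim] at hprod
  refine hprod.congr' ?_
  filter_upwards [eventually_gt_atTop 0, hΔ.eventually_const_lt hΔ_inf,
    (hJ.symm.tendsto_atTop hI).eventually_gt_atTop 0] with T hT hΔT hJT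
  rw [div_pow, Real.sq_sqrt hJT.le, Function.comp_apply]
  field_simp

variable {Ω : Type*} [MeasurableSpace Ω] {Θ : Set ℝ} {P : ℝ → Measure Ω}
  {X : ℝ → ℝ≥0 → Ω → ℤ} {ϑ : ℝ}

theorem isLAN_observationLaw (hΘ : Θ ⊆ Set.Ioi 0)
    (hX : ∀ θ ∈ Θ, IsSymmetricCompoundPoisson (P θ) θ (X θ)) (hϑ : ϑ ∈ Θ)
    (hΔ : ∀ T, 0 < T → 0 < Δ T) (hΔ_inf : 0 < Δ_inf) (hlim : Tendsto Δ atTop (𝓝 Δ_inf))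
    (hJ_pos : ∀ T, 0 < T → 0 < J T)
    (hJ : J ~[atTop] fun T => T * Δ_inf * fisherInfo (ϑ * Δ_inf)) :
    IsLAN Θ (fun T θ => observationLaw (P θ) (X θ) T (Δ T)) ϑ J := by
  have hϑ_pos : 0 < ϑ := hΘ hϑ
  have hx₀ : 0 < ϑ * Δ_inf := mul_pos hϑ_pos hΔ_inf
  have hx : Tendsto (fun T => ϑ * Δ T) atTop (𝓝 (ϑ * Δ_inf)) := hlim.const_mul ϑ
  have hn : Tendsto (fun T => ⌊T / Δ T⌋₊) atTop atTop :=
    tendsto_nat_floor_atTop.comp (tendsto_id_div_atTop hΔ_inf hlim)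
  have hnh := tendsto_natFloor_div_mul_sq_div_sqrt (fisherInfo_pos hx₀) hΔ_inf hlim hJ
  have hmap : ∀ᶠ T in atTop, MeasurePreserving differences (observationLaw (P ϑ) (X ϑ) T (Δ T))
      (Measure.pi fun _ => skellamMeasure (ϑ * Δ T)) := by
    filter_upwards [eventually_gt_atTop 0] with T hT
    exact ⟨measurable_of_countable _,
      (hX ϑ hϑ).map_differences_observationLaw hϑ_pos.le T (hΔ T hT).le⟩
  refine ⟨hJ_pos, fun T y => ∑ j, Δ T / √(J T) * score (ϑ * Δ T) (differences y j),
    fun T => measurable_of_countable _, fun g => ?_, fun v => ⟨fun T y =>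
      lanRemainder (ϑ * Δ T) (v * (Δ T / √(J T))) (v ^ 2) (differences y),
      fun T => measurable_of_countable _, fun T hT hmem => ?_, fun δ hδ => ?_⟩⟩
  · have hclt := (ProbabilityMeasure.tendsto_iff_forall_integral_tendsto.1
      (tendstoInDistribution_sum_score hx₀ hx hn hnh).tendsto) g
    simp only [ProbabilityMeasure.coe_mk, Measure.map_id] at hclt
    refine hclt.congr' (hmap.mono fun T hT => ?_)
    rw [integral_map (measurable_of_countable _).aemeasurable
      g.continuous.aestronglyMeasurable, ← hT.map_eq, integral_map hT.aemeasurable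
      (measurable_of_countable _).aestronglyMeasurable]
  · filter_upwards [(hX ϑ hϑ).toReal_rnDeriv_observationLaw hϑ_pos (hX _ hmem) (hΘ hmem) T
      (hΔ T hT)] with y hy
    rw [hy, lanRemainder, add_mul, div_mul_eq_mul_div, mul_div_assoc, ← Finset.mul_sum]
    ring_nf
  · refine (tendsto_measure_le_abs_of_tendsto_lintegral_enorm
      (fun _ => (measurable_of_countable _).aemeasurable)
      (tendsto_lintegral_enorm_lanRemainder hx₀ hx hn hnh v) hδ).congr' (hmap.mono fun T hT => ?_)
    exact (hT.measure_preimage (Set.to_countable _).measurableSet.nullMeasurableSet).symm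

end LAN

theorem theorem1_general {Ω : Type*} [MeasurableSpace Ω] {Θ : Set ℝ} (hΘ : Θ ⊆ Set.Ioi 0)
    {P : ℝ → Measure Ω} {X : ℝ → ℝ≥0 → Ω → ℤ}
    (hX : ∀ ϑ ∈ Θ, IsSymmetricCompoundPoisson (P ϑ) ϑ (X ϑ))
    {Δ : ℝ → ℝ} (hΔ : ∀ T, 0 < T → 0 < Δ T)
    {Δ_inf : ℝ} (hΔ_inf : 0 < Δ_inf) (hlim : Tendsto Δ atTop (𝓝 Δ_inf)) {ϑ : ℝ} (hϑ : ϑ ∈ Θ) :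
    ((fun T => scaleInformation (P ϑ) (X ϑ) T (Δ T) ϑ) ~[atTop]
        fun T => scaleInformation (P ϑ) (X ϑ) T Δ_inf ϑ) ∧
      ∀ J : ℝ → ℝ, (∀ T, 0 < T → 0 < J T) →
        (J ~[atTop] fun T => scaleInformation (P ϑ) (X ϑ) T Δ_inf ϑ) →
        IsLAN Θ (fun T θ => observationLaw (P θ) (X θ) T (Δ T)) ϑ J := by
  have hϑ_pos : 0 < ϑ := hΘ hϑ
  have hx₀ : 0 < ϑ * Δ_inf := mul_pos hϑ_pos hΔ_inf
  have hinfo : ∀ T, scaleInformation (P ϑ) (X ϑ) T Δ_inf ϑ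
      = T * Δ_inf * fisherInfo (ϑ * Δ_inf) := fun T =>
    (hX ϑ hϑ).scaleInformation_eq hϑ_pos T hΔ_inf
  simp only [hinfo]
  refine ⟨?_, fun J => isLAN_observationLaw hΘ hX hϑ hΔ hΔ_inf hlim⟩
  have hfactor : (fun T => Δ T * fisherInfo (ϑ * Δ T)) ~[atTop]
      fun _ => Δ_inf * fisherInfo (ϑ * Δ_inf) :=
    (isEquivalent_const_iff_tendsto (mul_pos hΔ_inf (fisherInfo_pos hx₀)).ne').2
      (hlim.mul ((continuousAt_fisherInfo hx₀).tendsto.comp (hlim.const_mul ϑ)))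
  refine ((IsEquivalent.refl (u := id)).mul hfactor).congr_left ?_ |>.congr_right ?_
  · filter_upwards [eventually_gt_atTop 0] with T hT
    rw [(hX ϑ hϑ).scaleInformation_eq hϑ_pos T (hΔ T hT), mul_assoc]
    rfl
  · exact Eventually.of_forall fun T => (mul_assoc _ _ _).symm

theorem theorem1 {Ω : Type*} [MeasurableSpace Ω]
    (Θ : Set ℝ) (hΘ : Θ ⊆ Set.Ioi 0) (hΘ_int : (interior Θ).Nonempty)
    (P : ℝ → Measure Ω) (X : ℝ → ℝ≥0 → Ω → ℤ)
    (hX : ∀ ϑ ∈ Θ, IsSymmetricCompoundPoisson (P ϑ) ϑ (X ϑ))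
    (Δ : ℝ → ℝ) (hΔ : ∀ T, 0 < T → 0 < Δ T ∧ Δ T ≤ T)
    (Δ_inf : ℝ) (hΔ_inf : 0 < Δ_inf) (hlim : Tendsto Δ atTop (𝓝 Δ_inf)) :
    ∀ ϑ ∈ Θ,
      IsLAN Θ (fun T θ => observationLaw (P θ) (X θ) T (Δ T)) ϑ
        (fun T => scaleInformation (P ϑ) (X ϑ) T (Δ T) ϑ) ∧
      (fun T => scaleInformation (P ϑ) (X ϑ) T (Δ T) ϑ) ~[atTop]
        (fun T => scaleInformation (P ϑ) (X ϑ) T Δ_inf ϑ) ∧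
      IsLAN Θ (fun T θ => observationLaw (P θ) (X θ) T (Δ T)) ϑ
        (fun T => scaleInformation (P ϑ) (X ϑ) T Δ_inf ϑ) := by
  intro ϑ hϑ
  obtain ⟨hequiv, hLAN⟩ := theorem1_general hΘ hX (fun T hT => (hΔ T hT).1) hΔ_inf hlim hϑ
  have hpos := fun T hT D => (hX ϑ hϑ).scaleInformation_pos (T := T) (Δ := D) (hΘ hϑ) hT
  exact ⟨hLAN _ (fun T hT => hpos T hT _ (hΔ T hT).1) hequiv, hequiv,
    hLAN _ (fun T hT => hpos T hT _ hΔ_inf) .refl⟩
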